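/- Let $L>0$, $\lambda>0$, and consider on the torus $\Omega=[0,L]^2$ the two-dimensional modified Kuramoto--Sivashinsky equation $$u_t=-\Delta^2u-\Delta u+\lambda u-u^3-u(u_x+u_y)$$ with periodic boundary conditions. A solution is a function $u(t,x,y)$, $L$-periodic in $x$ and $y$, with initial datum $u(0)\in L^2(\Omega)$, smooth and satisfying the equation pointwise for $t>0$, and with $u(t)\to u(0)$ in $L^2(\Omega)$ as $t\to0^+$. Put $$J_n(t)=\sum_{i+j=n}\frac{n!}{i!\,j!}\int_\Omega(\partial_x^i\partial_y^ju)^2\,dx\,dy,\qquad \|u\|_\infty=\sup_\Omega|u|.$$ Let $\mathcal U$ be any family of solutions (for instance all solutions, or a single one), and for a functional $F$ of the solution let $\overline F=\sup_{u\in\mathcal U}\limsup_{t\to\infty}F(u(t))$. Let $K=\sum_{n\ge0}(-1)^n(2n+1)^{-2}=0.9159\ldots$ be Catalan's constant, and put $$G(a)=108+4\lambda^2+108\Bigl(\tfrac{5}{\sqrt\pi}\Bigr)^4a^2+108\Bigl(\tfrac{78}{\pi}\Bigr)^4a^4 .$$ Then $$\overline{\|u\|}_\infty\le\frac{L}{2\pi}\sqrt{\frac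 K6}\;\overline J_2^{\,1/2}+L^{-1}\,\overline J_0^{\,1/2},$$ where $$\overline J_0\le B_0:=L^2\Bigl(\lambda+\frac14\Bigr),\qquad \overline J_2\le\overline J_0\,G(\overline J_0)^{1/2}.$$ Moreover, explicitly, $$\overline{\|u\|}_\infty\le\frac{L}{2\pi^3}\sqrt{6K}\;\Bigl(B_0^{3/2}\,G(B_0)^{1/2}\Bigr)^{1/2}+L^{-1}B_0^{1/2}.$$ -/

import Mathlib

open MeasureTheory Filter Topology Set
open scoped ENNReal ContDiff

noncomputable section

namespace MKSE

/-- The square `Ω = [0, L]²`, a fundamental domain of the torus. -/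
def square (L : ℝ) : Set (ℝ × ℝ) := Icc 0 L ×ˢ Icc 0 L

/-- The partial derivative `∂φ/∂x` of a function of `(x, y)`. -/
def dx (φ : ℝ × ℝ → ℝ) : ℝ × ℝ → ℝ := fun p => deriv (fun s => φ (s, p.2)) p.1

/-- The partial derivative `∂φ/∂y` of a function of `(x, y)`. -/
def dy (φ : ℝ × ℝ → ℝ) : ℝ × ℝ → ℝ := fun p => deriv (fun s => φ (p.1, s)) p.2

/-- The Laplacian `Δφ = φ_xx + φ_yy`. -/
def lap (φ : ℝ × ℝ → ℝ) : ℝ × ℝ → ℝ := fun p => dx (dx φ) p + dy (dy φ) p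

/-- The (squared) homogeneous Sobolev norm
`J_n = ∑_{i + j = n} n! / (i! j!) ∫_Ω (∂_x^i ∂_y^j φ)² dx dy`. -/
def J (L : ℝ) (n : ℕ) (φ : ℝ × ℝ → ℝ) : ℝ≥0∞ :=
  ∑ ij ∈ Finset.HasAntidiagonal.antidiagonal n,
    (n.choose ij.1 : ℝ≥0∞) * ∫⁻ p in square L, ‖(dx^[ij.1] (dy^[ij.2] φ)) p‖ₑ ^ 2

/-- The sup-norm `‖φ‖_∞ = sup_{p ∈ Ω} |φ(p)|`. -/
def supNorm (L : ℝ) (φ : ℝ × ℝ → ℝ) : ℝ≥0∞ := ⨆ p ∈ square L, ‖φ p‖ₑ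

/-- `u` is an `L`-periodic solution, with initial datum `u 0 ∈ L²(Ω)`, of
`u_t = -Δ²u - Δu + lam u - u³ - u (u_x + u_y)` on the two-dimensional torus: it is smooth and
satisfies the equation pointwise for positive times (the equation is parabolic and smooths its
`L²` data instantaneously), and it attains its initial datum in `L²(Ω)`. -/
structure IsSolution (L lam : ℝ) (u : ℝ → ℝ × ℝ → ℝ) : Prop where
  periodic_x : ∀ t, 0 ≤ t → ∀ x y, u t (x + L, y) = u t (x, y)
  periodic_y : ∀ t, 0 ≤ t → ∀ x y, u t (x, y + L) = u t (x, y)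
  initial_memLp : MemLp (u 0) 2 (volume.restrict (square L))
  tendsto_initial :
    Tendsto (fun t => eLpNorm (fun p => u t p - u 0 p) 2 (volume.restrict (square L)))
      (𝓝[>] 0) (𝓝 0)
  smooth : ContDiffOn ℝ ∞ (fun z : ℝ × (ℝ × ℝ) => u z.1 z.2) (Ioi 0 ×ˢ univ)
  equation : ∀ t, 0 < t → ∀ p,
    deriv (fun s => u s p) t =
      -lap (lap (u t)) p - lap (u t) p + lam * u t p - u t p ^ 3
        - u t p * (dx (u t) p + dy (u t) p)

/-- The overbar: the limit superior of `F (u t)` as `t → ∞`, followed by the supremum over the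
solutions `u` in the family `U` (all solutions, or one solution, for example). -/
def overbar (U : Set (ℝ → ℝ × ℝ → ℝ)) (F : (ℝ × ℝ → ℝ) → ℝ≥0∞) : ℝ≥0∞ :=
  ⨆ u ∈ U, limsup (fun t => F (u t)) atTop

/-- Catalan's constant `K = ∑_{n ≥ 0} (-1)^n / (2n + 1)²`. -/
def catalanConst : ℝ := ∑' n : ℕ, (-1 : ℝ) ^ n / (2 * (n : ℝ) + 1) ^ 2

/-- The upper bound `L² (lam + 1/4)` for `J_0` as time goes to infinity. -/
def B₀ (L lam : ℝ) : ℝ := L ^ 2 * (lam + 1 / 4)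

/-- The bracket `108 + 4 lam² + 108 (5/√π)⁴ a² + 108 (78/π)⁴ a⁴`. -/
def bracket (lam : ℝ) (a : ℝ≥0∞) : ℝ≥0∞ :=
  ENNReal.ofReal (108 + 4 * lam ^ 2)
    + ENNReal.ofReal (108 * (5 / √Real.pi) ^ 4) * a ^ 2
    + ENNReal.ofReal (108 * (78 / Real.pi) ^ 4) * a ^ 4

end MKSE

end

/-! ### Calculus and integration by parts for doubly periodic functions. -/

namespace MKSE

/-! Write A0 = ∫u², A1 = ∫|∇u|², A2 = ∫(Δu)², A3 = ∫|∇Δu|², A4 = ∫(Δ²u)². Periodicity gives J_0 = A0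
and J_2 = A2, and for positive times everything is smooth, so the whole argument consists of
pointwise bounds, energy identities and scalar comparison.

Sup-norm. Expand u in Fourier series. The zero mode is the mean, at most A0^{1/2}/L. The rest is
bounded by Cauchy–Schwarz through A2 and the sum of |k|⁻⁴ over nonzero lattice points
(`Per.sub_mean_sq_le`). By Jacobi's two-square theorem (`normCount_eq`) the number of lattice points
of norm n is four times a divisor sum of the character mod 4, so the lattice sum factors as 4 ζ(2)
K; this is where Catalan's constant comes from.

J_0. Testing with u, the convection term is an exact derivative, A1 ≤ A2 + A0/4, and ∫u⁴ ≥ A0²/L².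
This leaves a logistic inequality with equilibrium B_0 (`Per.energy_le`).

J_2. Testing with Δ²u, completing a square in the cubic term leaves 3∫|∇u|⁴. The gradient is bounded
by Agmon's inequality sup|∇u|² ≤ (A1 A3)^{1/2} (`Per.agmon_grad`). Interpolating between A0 and A4
and using Young's inequality gives (1/2) dA2/dt ≤ -A4/4 + G(A0) A0/4 (`ladder_le_bracket`). Since A4
≥ A2²/A0, A2 cannot stay above A0 G(A0)^{1/2}.

Explicit bound. It amounts to J_2 ≤ (36/π⁴) B_0^{3/2} G(B_0)^{1/2}. If B_0 > π⁸/1296 the factor 36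
B_0^{1/2}/π⁴ exceeds 1 and the previous bound suffices. Otherwise L is small enough for Poincaré's
inequality to absorb linear terms: for B_0 ≤ 1 it absorbs everything and J_2 tends to 0; in between,
the linear terms disappear and the large quartic coefficient of G covers the nonlinear ones. -/

/-- Smooth functions on the plane that are `L`-periodic in both variables. -/
structure Per (L : ℝ) (φ : ℝ × ℝ → ℝ) : Prop where
  smooth : ContDiff ℝ ∞ φ
  px : ∀ x y, φ (x + L, y) = φ (x, y)
  py : ∀ x y, φ (x, y + L) = φ (x, y)

variable {L : ℝ} {φ ψ χ : ℝ × ℝ → ℝ}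

theorem hasDerivAt_fst_of_differentiableAt {p : ℝ × ℝ} (h : DifferentiableAt ℝ φ p) :
    HasDerivAt (fun s => φ (s, p.2)) (fderiv ℝ φ p (1, 0)) p.1 := by
  have h1 : HasDerivAt (fun s : ℝ => (s, p.2)) ((1 : ℝ), (0 : ℝ)) p.1 :=
    (hasDerivAt_id p.1).prodMk (hasDerivAt_const p.1 p.2)
  exact h.hasFDerivAt.comp_hasDerivAt p.1 h1

theorem hasDerivAt_snd_of_differentiableAt {p : ℝ × ℝ} (h : DifferentiableAt ℝ φ p) :
    HasDerivAt (fun s => φ (p.1, s)) (fderiv ℝ φ p (0, 1)) p.2 := by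
  have h1 : HasDerivAt (fun s : ℝ => (p.1, s)) ((0 : ℝ), (1 : ℝ)) p.2 :=
    (hasDerivAt_const p.2 p.1).prodMk (hasDerivAt_id p.2)
  exact h.hasFDerivAt.comp_hasDerivAt p.2 h1

theorem dx_eq_fderiv {p : ℝ × ℝ} (h : DifferentiableAt ℝ φ p) :
    dx φ p = fderiv ℝ φ p (1, 0) := (hasDerivAt_fst_of_differentiableAt h).deriv

theorem dy_eq_fderiv {p : ℝ × ℝ} (h : DifferentiableAt ℝ φ p) :
    dy φ p = fderiv ℝ φ p (0, 1) := (hasDerivAt_snd_of_differentiableAt h).deriv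

namespace Per

theorem differentiable (h : Per L φ) : Differentiable ℝ φ := h.smooth.differentiable (by simp)

theorem continuous (h : Per L φ) : Continuous φ := h.smooth.continuous

theorem hasDerivAt_dx (h : Per L φ) (x y : ℝ) :
    HasDerivAt (fun s => φ (s, y)) (dx φ (x, y)) x := by
  rw [dx_eq_fderiv (h.differentiable _)]
  exact hasDerivAt_fst_of_differentiableAt (h.differentiable (x, y))

theorem hasDerivAt_dy (h : Per L φ) (x y : ℝ) :
    HasDerivAt (fun s => φ (x, s)) (dy φ (x, y)) y := by
  rw [dy_eq_fderiv (h.differentiable _)]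
  exact hasDerivAt_snd_of_differentiableAt (h.differentiable (x, y))

theorem add (h : Per L φ) (k : Per L ψ) : Per L (fun p => φ p + ψ p) :=
  ⟨h.smooth.add k.smooth, fun x y => by simp [h.px, k.px], fun x y => by simp [h.py, k.py]⟩

theorem sub (h : Per L φ) (k : Per L ψ) : Per L (fun p => φ p - ψ p) :=
  ⟨h.smooth.sub k.smooth, fun x y => by simp [h.px, k.px], fun x y => by simp [h.py, k.py]⟩

theorem mul (h : Per L φ) (k : Per L ψ) : Per L (fun p => φ p * ψ p) :=
  ⟨h.smooth.mul k.smooth, fun x y => by simp [h.px, k.px], fun x y => by simp [h.py, k.py]⟩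

theorem neg (h : Per L φ) : Per L (fun p => -φ p) :=
  ⟨h.smooth.neg, fun x y => by simp [h.px], fun x y => by simp [h.py]⟩

theorem const (c : ℝ) : Per L (fun _ => c) :=
  ⟨contDiff_const, fun _ _ => rfl, fun _ _ => rfl⟩

theorem const_mul (h : Per L φ) (c : ℝ) : Per L (fun p => c * φ p) := (const c).mul h

theorem pow (h : Per L φ) (n : ℕ) : Per L (fun p => φ p ^ n) :=
  ⟨h.smooth.pow n, fun x y => by simp [h.px], fun x y => by simp [h.py]⟩

theorem dx (h : Per L φ) : Per L (dx φ) := by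
  have e : MKSE.dx φ = fun p => fderiv ℝ φ p (1, 0) := by
    ext p; exact dx_eq_fderiv (h.differentiable p)
  refine ⟨?_, fun x y => ?_, fun x y => ?_⟩
  · rw [e]
    exact (h.smooth.fderiv_right (m := ∞) (by simp)).clm_apply contDiff_const
  · have := (h.hasDerivAt_dx (x + L) y).comp_add_const x L
    simp only [h.px] at this
    exact this.unique (h.hasDerivAt_dx x y)
  · simp only [MKSE.dx, h.py]

theorem dy (h : Per L φ) : Per L (dy φ) := by
  have e : MKSE.dy φ = fun p => fderiv ℝ φ p (0, 1) := by
    ext p; exact dy_eq_fderiv (h.differentiable p)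
  refine ⟨?_, fun x y => ?_, fun x y => ?_⟩
  · rw [e]
    exact (h.smooth.fderiv_right (m := ∞) (by simp)).clm_apply contDiff_const
  · simp only [MKSE.dy, h.px]
  · have := (h.hasDerivAt_dy x (y + L)).comp_add_const y L
    simp only [h.py] at this
    exact this.unique (h.hasDerivAt_dy x y)

theorem lap (h : Per L φ) : Per L (lap φ) := h.dx.dx.add h.dy.dy

theorem dx_dy_comm (h : Per L φ) : MKSE.dx (MKSE.dy φ) = MKSE.dy (MKSE.dx φ) := by
  have e : MKSE.dx φ = fun p => fderiv ℝ φ p (1, 0) := by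
    ext p; exact dx_eq_fderiv (h.differentiable p)
  have e' : MKSE.dy φ = fun p => fderiv ℝ φ p (0, 1) := by
    ext p; exact dy_eq_fderiv (h.differentiable p)
  have hd : Differentiable ℝ (fderiv ℝ φ) :=
    (h.smooth.fderiv_right (m := ∞) (by simp)).differentiable (by simp)
  ext p
  rw [dx_eq_fderiv (h.dy.differentiable p), dy_eq_fderiv (h.dx.differentiable p), e, e',
    fderiv_clm_apply (hd p) (differentiableAt_const _),
    fderiv_clm_apply (hd p) (differentiableAt_const _)]
  have hs : IsSymmSndFDerivAt ℝ φ p := h.smooth.contDiffAt.isSymmSndFDerivAt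
    (by rw [minSmoothness_of_isRCLikeNormedField]; exact WithTop.coe_le_coe.2 (le_top : (2 : ℕ∞) ≤ ⊤))
  simpa using hs.eq _ _

end Per

theorem dx_add (h : Per L φ) (k : Per L ψ) (p : ℝ × ℝ) :
    dx (fun p => φ p + ψ p) p = dx φ p + dx ψ p :=
  ((h.hasDerivAt_dx p.1 p.2).add (k.hasDerivAt_dx p.1 p.2)).deriv

theorem dy_add (h : Per L φ) (k : Per L ψ) (p : ℝ × ℝ) :
    dy (fun p => φ p + ψ p) p = dy φ p + dy ψ p :=
  ((h.hasDerivAt_dy p.1 p.2).add (k.hasDerivAt_dy p.1 p.2)).deriv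

theorem dx_mul (h : Per L φ) (k : Per L ψ) (p : ℝ × ℝ) :
    dx (fun p => φ p * ψ p) p = dx φ p * ψ p + φ p * dx ψ p :=
  ((h.hasDerivAt_dx p.1 p.2).mul (k.hasDerivAt_dx p.1 p.2)).deriv

theorem dy_mul (h : Per L φ) (k : Per L ψ) (p : ℝ × ℝ) :
    dy (fun p => φ p * ψ p) p = dy φ p * ψ p + φ p * dy ψ p :=
  ((h.hasDerivAt_dy p.1 p.2).mul (k.hasDerivAt_dy p.1 p.2)).deriv

theorem dx_pow (h : Per L φ) (n : ℕ) (p : ℝ × ℝ) :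
    dx (fun p => φ p ^ n) p = n * φ p ^ (n - 1) * dx φ p :=
  ((h.hasDerivAt_dx p.1 p.2).pow n).deriv

theorem dy_pow (h : Per L φ) (n : ℕ) (p : ℝ × ℝ) :
    dy (fun p => φ p ^ n) p = n * φ p ^ (n - 1) * dy φ p :=
  ((h.hasDerivAt_dy p.1 p.2).pow n).deriv

/-! ### Integrals over the period square; Green's identities and interpolation. -/

/-- The integral over the period square. -/
noncomputable def avg (L : ℝ) (φ : ℝ × ℝ → ℝ) : ℝ := ∫ p in square L, φ p

theorem isCompact_square (L : ℝ) : IsCompact (square L) := isCompact_Icc.prod isCompact_Icc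

theorem measurableSet_square (L : ℝ) : MeasurableSet (square L) :=
  measurableSet_Icc.prod measurableSet_Icc

theorem _root_.Continuous.integrableOn_square (h : Continuous φ) : IntegrableOn φ (square L) :=
  h.continuousOn.integrableOn_compact (isCompact_square L)

theorem avg_congr (h : ∀ p, φ p = ψ p) : avg L φ = avg L ψ := by
  rw [funext h]

theorem avg_add (h : Continuous φ) (k : Continuous ψ) :
    avg L (fun p => φ p + ψ p) = avg L φ + avg L ψ :=
  integral_add h.integrableOn_square k.integrableOn_square

theorem avg_sub (h : Continuous φ) (k : Continuous ψ) :
    avg L (fun p => φ p - ψ p) = avg L φ - avg L ψ :=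
  integral_sub h.integrableOn_square k.integrableOn_square

theorem avg_neg : avg L (fun p => -φ p) = -avg L φ := integral_neg _

theorem avg_const_mul (c : ℝ) : avg L (fun p => c * φ p) = c * avg L φ :=
  integral_const_mul _ _

theorem avg_const (hL : 0 ≤ L) (c : ℝ) : avg L (fun _ => c) = L ^ 2 * c := by
  have : (volume (square L)).toReal = L ^ 2 := by
    rw [square, Measure.volume_eq_prod, Measure.prod_prod, Real.volume_Icc, sub_zero,
      ENNReal.toReal_mul, ENNReal.toReal_ofReal hL, sq]
  rw [avg, setIntegral_const, Measure.real, this, smul_eq_mul]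

theorem avg_nonneg (h : ∀ p, 0 ≤ φ p) : 0 ≤ avg L φ := integral_nonneg h

theorem avg_mono (h : Continuous φ) (k : Continuous ψ) (hle : ∀ p, φ p ≤ ψ p) :
    avg L φ ≤ avg L ψ :=
  integral_mono h.integrableOn_square k.integrableOn_square hle

theorem avg_eq_xy (hL : 0 ≤ L) (h : Continuous φ) :
    avg L φ = ∫ x in 0..L, ∫ y in 0..L, φ (x, y) := by
  rw [avg, square, Measure.volume_eq_prod, setIntegral_prod _ h.integrableOn_square,
    intervalIntegral.integral_of_le hL, integral_Icc_eq_integral_Ioc]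
  refine integral_congr_ae (Eventually.of_forall fun x => ?_)
  simp only [intervalIntegral.integral_of_le hL, integral_Icc_eq_integral_Ioc]

theorem avg_swap (φ : ℝ × ℝ → ℝ) : avg L φ = avg L (fun p => φ (p.2, p.1)) := by
  unfold avg square
  rw [Measure.volume_eq_prod]
  exact (setIntegral_prod_swap (Icc 0 L) (Icc 0 L) (f := φ)).symm

theorem avg_eq_yx (hL : 0 ≤ L) (h : Continuous φ) :
    avg L φ = ∫ y in 0..L, ∫ x in 0..L, φ (x, y) := by
  rw [avg_swap, avg_eq_xy hL (φ := fun p => φ (p.2, p.1)) (h.comp continuous_swap)]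

theorem Per.avg_dx (h : Per L φ) (hL : 0 ≤ L) : avg L (MKSE.dx φ) = 0 := by
  rw [avg_eq_yx hL h.dx.continuous]
  refine (intervalIntegral.integral_congr fun y _ => ?_).trans intervalIntegral.integral_zero
  have := intervalIntegral.integral_eq_sub_of_hasDerivAt (a := 0) (b := L)
    (fun x _ => h.hasDerivAt_dx x y)
    ((h.dx.continuous.comp (by fun_prop : Continuous fun x : ℝ => (x, y))).intervalIntegrable _ _)
  have h0 := h.px 0 y
  rw [zero_add] at h0
  simpa [h0] using this

theorem Per.avg_dy (h : Per L φ) (hL : 0 ≤ L) : avg L (MKSE.dy φ) = 0 := by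
  rw [avg_eq_xy hL h.dy.continuous]
  refine (intervalIntegral.integral_congr fun x _ => ?_).trans intervalIntegral.integral_zero
  have := intervalIntegral.integral_eq_sub_of_hasDerivAt (a := 0) (b := L)
    (fun y _ => h.hasDerivAt_dy x y)
    ((h.dy.continuous.comp (by fun_prop : Continuous fun y : ℝ => (x, y))).intervalIntegrable _ _)
  have h0 := h.py x 0
  rw [zero_add] at h0
  simpa [h0] using this

theorem avg_mul_dx (h : Per L φ) (k : Per L ψ) (hL : 0 ≤ L) :
    avg L (fun p => φ p * dx ψ p) = -avg L (fun p => dx φ p * ψ p) := by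
  have h1 := (h.mul k).avg_dx hL
  rw [avg_congr (dx_mul h k), avg_add (h.dx.mul k).continuous (h.mul k.dx).continuous] at h1
  linarith

theorem avg_mul_dy (h : Per L φ) (k : Per L ψ) (hL : 0 ≤ L) :
    avg L (fun p => φ p * dy ψ p) = -avg L (fun p => dy φ p * ψ p) := by
  have h1 := (h.mul k).avg_dy hL
  rw [avg_congr (dy_mul h k), avg_add (h.dy.mul k).continuous (h.mul k.dy).continuous] at h1
  linarith

/-- Green's first identity. -/
theorem avg_mul_lap (h : Per L φ) (k : Per L ψ) (hL : 0 ≤ L) :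
    avg L (fun p => φ p * lap ψ p) = -avg L (fun p => dx φ p * dx ψ p + dy φ p * dy ψ p) := by
  rw [avg_add (h.dx.mul k.dx).continuous (h.dy.mul k.dy).continuous, neg_add,
    ← avg_mul_dx h k.dx hL, ← avg_mul_dy h k.dy hL,
    ← avg_add (h.mul k.dx.dx).continuous (h.mul k.dy.dy).continuous]
  exact avg_congr fun p => mul_add _ _ _

/-- Green's second identity. -/
theorem avg_mul_lap_comm (h : Per L φ) (k : Per L ψ) (hL : 0 ≤ L) :
    avg L (fun p => φ p * lap ψ p) = avg L (fun p => lap φ p * ψ p) := by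
  rw [avg_mul_lap h k hL, avg_congr fun p => mul_comm (lap φ p) (ψ p), avg_mul_lap k h hL]
  congr 1
  exact avg_congr fun p => by ring

/-- The Cauchy–Schwarz inequality from nonnegativity of the quadratic form. -/
theorem sq_le_mul_of_quadratic_nonneg {a b c : ℝ} (h : ∀ s : ℝ, 0 ≤ a * s ^ 2 + 2 * b * s + c) :
    b ^ 2 ≤ a * c := by
  have := discrim_le_zero (a := a) (b := 2 * b) (c := c) fun s => by nlinarith [h s]
  rw [discrim] at this
  linarith

theorem avg_mul_sq_le (h : Continuous φ) (k : Continuous ψ) :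
    avg L (fun p => φ p * ψ p) ^ 2 ≤ avg L (fun p => φ p ^ 2) * avg L (fun p => ψ p ^ 2) := by
  refine sq_le_mul_of_quadratic_nonneg fun s => ?_
  have : avg L (fun p => (s * φ p + ψ p) ^ 2) =
      avg L (fun p => φ p ^ 2) * s ^ 2 + 2 * avg L (fun p => φ p * ψ p) * s
        + avg L (fun p => ψ p ^ 2) := by
    rw [avg_congr (ψ := fun p => (s ^ 2 * φ p ^ 2 + 2 * s * (φ p * ψ p)) + ψ p ^ 2)
      fun p => by ring, avg_add (by fun_prop) (by fun_prop), avg_add (by fun_prop) (by fun_prop),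
      avg_const_mul, avg_const_mul]
    ring
  rw [← this]
  exact avg_nonneg fun p => sq_nonneg _

/-- The Dirichlet integral. -/
noncomputable def grad2 (L : ℝ) (φ : ℝ × ℝ → ℝ) : ℝ := avg L (fun p => dx φ p ^ 2 + dy φ p ^ 2)

theorem Per.grad2_eq (h : Per L φ) (hL : 0 ≤ L) :
    grad2 L φ = -avg L (fun p => φ p * MKSE.lap φ p) := by
  rw [avg_mul_lap h h hL, neg_neg]
  exact avg_congr fun p => by ring

/-- Green's identity and Cauchy–Schwarz. Applied to φ and to Δφ it yields A1² ≤ A0 A2 and A3² ≤ A2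
A4. -/
theorem Per.grad2_sq_le (h : Per L φ) (hL : 0 ≤ L) :
    grad2 L φ ^ 2 ≤ avg L (fun p => φ p ^ 2) * avg L (fun p => MKSE.lap φ p ^ 2) := by
  rw [h.grad2_eq hL, neg_sq]
  exact avg_mul_sq_le h.continuous h.lap.continuous

theorem Per.avg_lap_sq_sq_le (h : Per L φ) (hL : 0 ≤ L) :
    avg L (fun p => MKSE.lap φ p ^ 2) ^ 2 ≤
      avg L (fun p => φ p ^ 2) * avg L (fun p => MKSE.lap (MKSE.lap φ) p ^ 2) := by
  have : avg L (fun p => MKSE.lap φ p ^ 2) = avg L (fun p => φ p * MKSE.lap (MKSE.lap φ) p) := by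
    rw [avg_mul_lap_comm h h.lap hL]
    exact avg_congr fun p => by ring
  rw [this]
  exact avg_mul_sq_le h.continuous h.lap.lap.continuous

/-- The integral of the squared Hessian is that of the squared Laplacian. -/
theorem Per.avg_hessian (h : Per L φ) (hL : 0 ≤ L) :
    avg L (fun p => MKSE.dx (MKSE.dx φ) p ^ 2) + 2 * avg L (fun p => MKSE.dx (MKSE.dy φ) p ^ 2)
      + avg L (fun p => MKSE.dy (MKSE.dy φ) p ^ 2) = avg L (fun p => MKSE.lap φ p ^ 2) := by
  -- Two integrations by parts, one in each variable, move the derivatives of the mixed product onto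
  -- a square.
  have h1 : avg L (fun p => MKSE.dx (MKSE.dx φ) p * MKSE.dy (MKSE.dy φ) p) =
      avg L (fun p => MKSE.dx (MKSE.dy φ) p ^ 2) := by
    rw [avg_mul_dy h.dx.dx h.dy hL, ← h.dx.dx_dy_comm, ← h.dx_dy_comm,
      avg_congr fun p => mul_comm (MKSE.dx (MKSE.dx (MKSE.dy φ)) p) (MKSE.dy φ p),
      avg_mul_dx h.dy h.dy.dx hL, neg_neg]
    exact avg_congr fun p => by ring
  rw [avg_congr (φ := fun p => MKSE.lap φ p ^ 2) (ψ := fun p => (MKSE.dx (MKSE.dx φ) p ^ 2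
    + 2 * (MKSE.dx (MKSE.dx φ) p * MKSE.dy (MKSE.dy φ) p)) + MKSE.dy (MKSE.dy φ) p ^ 2)
    fun p => by simp only [MKSE.lap]; ring, avg_add, avg_add, avg_const_mul, h1]
  · exact (h.dx.dx.pow 2).continuous
  · exact ((h.dx.dx.mul h.dy.dy).const_mul 2).continuous
  · exact ((h.dx.dx.pow 2).add ((h.dx.dx.mul h.dy.dy).const_mul 2)).continuous
  · exact (h.dy.dy.pow 2).continuous

end MKSE

/-! ### Joint smoothness in time and space, and time derivatives of integrals. -/

namespace MKSE

section DirectionalDerivatives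

variable {E : Type*} [NormedAddCommGroup E] [NormedSpace ℝ E] {G : E → ℝ} {S : Set E}

theorem contDiffOn_fderiv_apply (hS : IsOpen S) (hG : ContDiffOn ℝ ∞ G S) (v : E) :
    ContDiffOn ℝ ∞ (fun z => fderiv ℝ G z v) S :=
  (hG.fderiv_of_isOpen hS (m := ∞) (by simp)).clm_apply contDiffOn_const

theorem fderiv_fderiv_apply_comm (hS : IsOpen S) (hG : ContDiffOn ℝ ∞ G S) (v w : E) {z : E}
    (hz : z ∈ S) : fderiv ℝ (fun z => fderiv ℝ G z v) z w
      = fderiv ℝ (fun z => fderiv ℝ G z w) z v := by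
  have hd : DifferentiableAt ℝ (fderiv ℝ G) z :=
    ((hG.fderiv_of_isOpen hS (m := ∞) (by simp)).contDiffAt (hS.mem_nhds hz)).differentiableAt
      (by simp)
  rw [fderiv_clm_apply hd (differentiableAt_const _),
    fderiv_clm_apply hd (differentiableAt_const _)]
  have hs : IsSymmSndFDerivAt ℝ G z := (hG.contDiffAt (hS.mem_nhds hz)).isSymmSndFDerivAt
    (by rw [minSmoothness_of_isRCLikeNormedField]; exact WithTop.coe_le_coe.2 (le_top : (2 : ℕ∞) ≤ ⊤))
  simpa using hs.eq _ _

end DirectionalDerivatives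

/-- Functions of time and space, jointly smooth for positive times. -/
def JointSmooth (F : ℝ → ℝ × ℝ → ℝ) : Prop :=
  ContDiffOn ℝ ∞ (fun z : ℝ × (ℝ × ℝ) => F z.1 z.2) (Ioi 0 ×ˢ univ)

/-- The time derivative. -/
noncomputable def dt (F : ℝ → ℝ × ℝ → ℝ) (t : ℝ) (p : ℝ × ℝ) : ℝ := deriv (fun s => F s p) t

theorem isOpen_posTime : IsOpen (Ioi (0 : ℝ) ×ˢ (univ : Set (ℝ × ℝ))) := isOpen_Ioi.prod isOpen_univ

namespace JointSmooth

variable {F G : ℝ → ℝ × ℝ → ℝ} {t : ℝ}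

theorem contDiffAt (h : JointSmooth F) (ht : 0 < t) (p : ℝ × ℝ) :
    ContDiffAt ℝ ∞ (fun z : ℝ × (ℝ × ℝ) => F z.1 z.2) (t, p) :=
  ContDiffOn.contDiffAt h (isOpen_posTime.mem_nhds ⟨ht, mem_univ _⟩)

theorem differentiableAt (h : JointSmooth F) (ht : 0 < t) (p : ℝ × ℝ) :
    DifferentiableAt ℝ (fun z : ℝ × (ℝ × ℝ) => F z.1 z.2) (t, p) :=
  (h.contDiffAt ht p).differentiableAt (by simp)

theorem slice (h : JointSmooth F) (ht : 0 < t) : ContDiff ℝ ∞ (F t) := by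
  rw [contDiff_iff_contDiffAt]
  intro p
  have h1 : ContDiffAt ℝ ∞ (fun q : ℝ × ℝ => (t, q)) p := contDiffAt_const.prodMk contDiffAt_id
  exact (h.contDiffAt ht p).comp p h1

theorem hasDerivAt_dt (h : JointSmooth F) (ht : 0 < t) (p : ℝ × ℝ) :
    HasDerivAt (fun s => F s p)
      (fderiv ℝ (fun z : ℝ × (ℝ × ℝ) => F z.1 z.2) (t, p) (1, 0)) t := by
  have h1 : HasDerivAt (fun s : ℝ => (s, p)) ((1 : ℝ), (0 : ℝ × ℝ)) t :=
    (hasDerivAt_id t).prodMk (hasDerivAt_const t p)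
  exact (h.differentiableAt ht p).hasFDerivAt.comp_hasDerivAt t h1

theorem dt_eq (h : JointSmooth F) (ht : 0 < t) (p : ℝ × ℝ) :
    dt F t p = fderiv ℝ (fun z : ℝ × (ℝ × ℝ) => F z.1 z.2) (t, p) (1, 0) :=
  (h.hasDerivAt_dt ht p).deriv

theorem fderiv_slice (h : JointSmooth F) (ht : 0 < t) (p v : ℝ × ℝ) :
    fderiv ℝ (F t) p v = fderiv ℝ (fun z : ℝ × (ℝ × ℝ) => F z.1 z.2) (t, p) (0, v) := by
  have h1 : HasFDerivAt (fun q : ℝ × ℝ => (t, q))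
      (ContinuousLinearMap.prod 0 (ContinuousLinearMap.id ℝ (ℝ × ℝ))) p :=
    (hasFDerivAt_const t p).prodMk (hasFDerivAt_id p)
  have h2 := (h.differentiableAt ht p).hasFDerivAt.comp p h1
  have h3 : fderiv ℝ (F t) p = _ := h2.fderiv
  rw [h3]
  simp

theorem dx_eq (h : JointSmooth F) (ht : 0 < t) (p : ℝ × ℝ) :
    MKSE.dx (F t) p = fderiv ℝ (fun z : ℝ × (ℝ × ℝ) => F z.1 z.2) (t, p) (0, (1, 0)) := by
  rw [dx_eq_fderiv ((h.slice ht).differentiable (by simp) p), h.fderiv_slice ht]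

theorem dy_eq (h : JointSmooth F) (ht : 0 < t) (p : ℝ × ℝ) :
    MKSE.dy (F t) p = fderiv ℝ (fun z : ℝ × (ℝ × ℝ) => F z.1 z.2) (t, p) (0, (0, 1)) := by
  rw [dy_eq_fderiv ((h.slice ht).differentiable (by simp) p), h.fderiv_slice ht]

theorem dx (h : JointSmooth F) : JointSmooth (fun t => MKSE.dx (F t)) :=
  (contDiffOn_fderiv_apply isOpen_posTime h (0, (1, 0))).congr fun z hz => h.dx_eq hz.1 z.2

theorem dy (h : JointSmooth F) : JointSmooth (fun t => MKSE.dy (F t)) :=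
  (contDiffOn_fderiv_apply isOpen_posTime h (0, (0, 1))).congr fun z hz => h.dy_eq hz.1 z.2

theorem dt (h : JointSmooth F) : JointSmooth (MKSE.dt F) :=
  (contDiffOn_fderiv_apply isOpen_posTime h (1, 0)).congr fun z hz => h.dt_eq hz.1 z.2

theorem add (h : JointSmooth F) (k : JointSmooth G) : JointSmooth (fun t p => F t p + G t p) :=
  ContDiffOn.add h k

theorem pow (h : JointSmooth F) (n : ℕ) : JointSmooth (fun t p => F t p ^ n) :=
  ContDiffOn.pow h n

theorem lap (h : JointSmooth F) : JointSmooth (fun t => MKSE.lap (F t)) := h.dx.dx.add h.dy.dy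

/-- Both sides are mixed second derivatives of one function on space-time, hence equal by symmetry
of the second derivative. -/
theorem dt_dx (h : JointSmooth F) (ht : 0 < t) :
    MKSE.dt (fun t => MKSE.dx (F t)) t = MKSE.dx (MKSE.dt F t) := by
  ext p
  rw [h.dx.dt_eq ht, h.dt.dx_eq ht]
  -- The formulas for partial derivatives hold only at positive times; this set is open, so they may
  -- still be differentiated at (t, p).
  have h1 : (fun z : ℝ × (ℝ × ℝ) => MKSE.dx (F z.1) z.2) =ᶠ[𝓝 (t, p)] _ :=
    Filter.eventuallyEq_of_mem (isOpen_posTime.mem_nhds ⟨ht, mem_univ _⟩)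
      fun z hz => h.dx_eq hz.1 z.2
  have h2 : (fun z : ℝ × (ℝ × ℝ) => MKSE.dt F z.1 z.2) =ᶠ[𝓝 (t, p)] _ :=
    Filter.eventuallyEq_of_mem (isOpen_posTime.mem_nhds ⟨ht, mem_univ _⟩)
      fun z hz => h.dt_eq hz.1 z.2
  rw [h1.fderiv_eq, h2.fderiv_eq]
  exact fderiv_fderiv_apply_comm isOpen_posTime h _ _ ⟨ht, mem_univ _⟩

theorem dt_dy (h : JointSmooth F) (ht : 0 < t) :
    MKSE.dt (fun t => MKSE.dy (F t)) t = MKSE.dy (MKSE.dt F t) := by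
  ext p
  rw [h.dy.dt_eq ht, h.dt.dy_eq ht]
  have h1 : (fun z : ℝ × (ℝ × ℝ) => MKSE.dy (F z.1) z.2) =ᶠ[𝓝 (t, p)] _ :=
    Filter.eventuallyEq_of_mem (isOpen_posTime.mem_nhds ⟨ht, mem_univ _⟩)
      fun z hz => h.dy_eq hz.1 z.2
  have h2 : (fun z : ℝ × (ℝ × ℝ) => MKSE.dt F z.1 z.2) =ᶠ[𝓝 (t, p)] _ :=
    Filter.eventuallyEq_of_mem (isOpen_posTime.mem_nhds ⟨ht, mem_univ _⟩)
      fun z hz => h.dt_eq hz.1 z.2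
  rw [h1.fderiv_eq, h2.fderiv_eq]
  exact fderiv_fderiv_apply_comm isOpen_posTime h _ _ ⟨ht, mem_univ _⟩

theorem dt_lap (h : JointSmooth F) (ht : 0 < t) (p : ℝ × ℝ) :
    MKSE.dt (fun t => MKSE.lap (F t)) t p = MKSE.lap (MKSE.dt F t) p := by
  have h1 := congrFun (h.dx.dt_dx ht) p
  have h2 := congrFun (h.dy.dt_dy ht) p
  rw [h.dt_dx ht] at h1
  rw [h.dt_dy ht] at h2
  have h3 : MKSE.dt (fun t => MKSE.lap (F t)) t p =
      MKSE.dt (fun t => MKSE.dx (MKSE.dx (F t))) t p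
        + MKSE.dt (fun t => MKSE.dy (MKSE.dy (F t))) t p :=
    deriv_add (h.dx.dx.hasDerivAt_dt ht p).differentiableAt
      (h.dy.dy.hasDerivAt_dt ht p).differentiableAt
  rw [h3, h1, h2]
  rfl

/-- Differentiation under the integral sign; the dominating constant is a bound of the time
derivative on the compact set [t/2, 2t] × Ω. -/
theorem hasDerivAt_avg (h : JointSmooth F) (L : ℝ) (ht : 0 < t) :
    HasDerivAt (fun s => avg L (F s)) (avg L (MKSE.dt F t)) t := by
  have hK : IsCompact (Icc (t / 2) (2 * t) ×ˢ square L) := isCompact_Icc.prod (isCompact_square L)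
  have hsub : Icc (t / 2) (2 * t) ×ˢ square L ⊆ Ioi (0 : ℝ) ×ˢ (univ : Set (ℝ × ℝ)) :=
    fun z hz => ⟨(half_pos ht).trans_le hz.1.1, mem_univ _⟩
  obtain ⟨C, hC⟩ := hK.exists_bound_of_continuousOn (h.dt.continuousOn.mono hsub)
  have hpos : ∀ s ∈ Ioo (t / 2) (2 * t), 0 < s := fun s hs => (half_pos ht).trans hs.1
  refine (hasDerivAt_integral_of_dominated_loc_of_deriv_le
    (F' := fun s p => MKSE.dt F s p) (bound := fun _ => C) (s := Ioo (t / 2) (2 * t))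
    (μ := volume.restrict (square L))
    (Ioo_mem_nhds (by linarith) (by linarith)) ?_ ?_ ?_ ?_ ?_ ?_).2
  · filter_upwards [Ioi_mem_nhds ht] with s hs
    exact (h.slice hs).continuous.aestronglyMeasurable
  · exact (h.slice ht).continuous.integrableOn_square
  · exact (h.dt.slice ht).continuous.aestronglyMeasurable
  · refine (ae_restrict_mem (measurableSet_square L)).mono fun p hp s hs => ?_
    exact hC (s, p) ⟨⟨hs.1.le, hs.2.le⟩, hp⟩
  · exact (continuous_const (y := C)).integrableOn_square
  · refine Eventually.of_forall fun p s hs => ?_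
    have := h.hasDerivAt_dt (hpos s hs) p
    rwa [← h.dt_eq (hpos s hs)] at this

theorem hasDerivAt_avg_sq (h : JointSmooth F) (L : ℝ) (ht : 0 < t) :
    HasDerivAt (fun s => avg L (fun p => F s p ^ 2))
      (2 * avg L (fun p => F t p * MKSE.dt F t p)) t := by
  have h1 := (h.pow 2).hasDerivAt_avg L ht
  rw [← avg_const_mul]
  convert! h1 using 1
  refine avg_congr fun p => ?_
  have h2 : MKSE.dt (fun t p => F t p ^ 2) t p = _ := ((h.hasDerivAt_dt ht p).pow 2).deriv
  rw [← h.dt_eq ht] at h2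
  rw [h2]
  push_cast
  ring

end JointSmooth

section Solutions

variable {L lam : ℝ} {u : ℝ → ℝ × ℝ → ℝ} {t : ℝ}

theorem IsSolution.jointSmooth (h : IsSolution L lam u) : JointSmooth u := h.smooth

theorem IsSolution.per (h : IsSolution L lam u) (ht : 0 < t) : Per L (u t) :=
  ⟨h.jointSmooth.slice ht, h.periodic_x t ht.le, h.periodic_y t ht.le⟩

theorem IsSolution.per_dt (h : IsSolution L lam u) (ht : 0 < t) : Per L (dt u t) := by
  have key : ∀ a b : ℝ × ℝ, (∀ s, 0 < s → u s a = u s b) → dt u t a = dt u t b := fun a b hab =>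
    Filter.EventuallyEq.deriv_eq (by filter_upwards [Ioi_mem_nhds ht] with s hs using hab s hs)
  exact ⟨h.jointSmooth.dt.slice ht, fun x y => key _ _ fun s hs => (h.per hs).px x y,
    fun x y => key _ _ fun s hs => (h.per hs).py x y⟩

theorem IsSolution.hasDerivAt_energy (h : IsSolution L lam u) (ht : 0 < t) :
    HasDerivAt (fun s => avg L (fun p => u s p ^ 2)) (2 * avg L (fun p => u t p * dt u t p)) t :=
  h.jointSmooth.hasDerivAt_avg_sq L ht

/-- Moving the second Laplacian by Green's identity leaves u_t undifferentiated, so the equation can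
be substituted directly. -/
theorem IsSolution.hasDerivAt_lap_energy (h : IsSolution L lam u) (hL : 0 ≤ L) (ht : 0 < t) :
    HasDerivAt (fun s => avg L (fun p => lap (u s) p ^ 2))
      (2 * avg L (fun p => lap (lap (u t)) p * dt u t p)) t := by
  have := h.jointSmooth.lap.hasDerivAt_avg_sq L ht
  rwa [avg_congr (fun p => by rw [h.jointSmooth.dt_lap ht p]),
    avg_mul_lap_comm (h.per ht).lap (h.per_dt ht) hL] at this

end Solutions

end MKSE

/-! ### Agmon's inequality for the gradient with constant one. -/

namespace MKSE

/-- On a circle, the oscillation of a function is at most half of its total variation. -/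
theorem abs_sub_le_half_variation {L r s : ℝ} {h h' : ℝ → ℝ} (hd : ∀ x, HasDerivAt h (h' x) x)
    (hc : Continuous h') (hp : ∀ x, h (x + L) = h x) (hsr : s ≤ r) (hrs : r ≤ s + L) :
    |h s - h r| ≤ (∫ x in 0..L, |h' x|) / 2 := by
  have hp' : Function.Periodic (fun x => |h' x|) L := fun x => by
    have := (hd (x + L)).comp_add_const x L
    simp only [hp] at this
    simp only [this.unique (hd x)]
  -- The points s and r cut the circle into two arcs. The increments over them are opposite, so each
  -- arc carries at least |h s - h r| of variation.
  have e1 : ∫ x in s..r, h' x = h r - h s :=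
    intervalIntegral.integral_eq_sub_of_hasDerivAt (fun x _ => hd x) (hc.intervalIntegrable _ _)
  have e2 : ∫ x in r..s + L, h' x = h s - h r := by
    rw [intervalIntegral.integral_eq_sub_of_hasDerivAt (fun x _ => hd x)
      (hc.intervalIntegrable _ _), hp]
  have i1 := intervalIntegral.abs_integral_le_integral_abs (f := h') (μ := volume) hsr
  have i2 := intervalIntegral.abs_integral_le_integral_abs (f := h') (μ := volume) hrs
  have e3 : (∫ x in s..r, |h' x|) + ∫ x in r..s + L, |h' x| = ∫ x in 0..L, |h' x| := by
    rw [intervalIntegral.integral_add_adjacent_intervals (hc.abs.intervalIntegrable _ _)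
      (hc.abs.intervalIntegrable _ _), hp'.intervalIntegral_add_eq s 0, zero_add]
  rw [e1, abs_sub_comm] at i1
  rw [e2] at i2
  linarith

/-- Average the oscillation bound over the comparison point r, which runs through a full period. -/
theorem le_average_add_half_variation {L : ℝ} (hL : 0 < L) {h h' : ℝ → ℝ}
    (hd : ∀ x, HasDerivAt h (h' x) x) (hc : Continuous h') (hp : ∀ x, h (x + L) = h x) (s : ℝ) :
    h s ≤ L⁻¹ * (∫ x in 0..L, h x) + (∫ x in 0..L, |h' x|) / 2 := by
  have hcont : Continuous h := continuous_iff_continuousAt.2 fun x => (hd x).continuousAt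
  have h1 : ∫ r in s..s + L, h s ≤ ∫ r in s..s + L, (h r + (∫ x in 0..L, |h' x|) / 2) := by
    refine intervalIntegral.integral_mono_on (by linarith) (by simp)
      ((hcont.add continuous_const).intervalIntegrable _ _) fun r hr => ?_
    have := le_of_abs_le (abs_sub_le_half_variation hd hc hp hr.1 hr.2)
    linarith
  have hper : Function.Periodic h L := hp
  rw [intervalIntegral.integral_add (hcont.intervalIntegrable _ _) (by simp),
    intervalIntegral.integral_const, intervalIntegral.integral_const, add_sub_cancel_left,
    hper.intervalIntegral_add_eq s 0, zero_add, smul_eq_mul, smul_eq_mul] at h1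
  have h2 := mul_le_mul_of_nonneg_left h1 (inv_nonneg.2 hL.le)
  rw [mul_add, inv_mul_cancel_left₀ hL.ne', inv_mul_cancel_left₀ hL.ne'] at h2
  exact h2

theorem intervalIntegral_abs_mul_sq_le {L : ℝ} (hL : 0 ≤ L) {f g : ℝ → ℝ} (hf : Continuous f)
    (hg : Continuous g) :
    (∫ x in 0..L, |f x * g x|) ^ 2 ≤ (∫ x in 0..L, f x ^ 2) * ∫ x in 0..L, g x ^ 2 := by
  refine sq_le_mul_of_quadratic_nonneg fun s => ?_
  have : ∫ x in 0..L, (s * |f x| + |g x|) ^ 2 = (∫ x in 0..L, f x ^ 2) * s ^ 2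
      + 2 * (∫ x in 0..L, |f x * g x|) * s + ∫ x in 0..L, g x ^ 2 := by
    have e : ∀ x, (s * |f x| + |g x|) ^ 2 = s ^ 2 * f x ^ 2 + 2 * s * |f x * g x| + g x ^ 2 :=
      fun x => by rw [abs_mul, ← sq_abs (f x), ← sq_abs (g x)]; ring
    simp only [e]
    rw [intervalIntegral.integral_add, intervalIntegral.integral_add,
      intervalIntegral.integral_const_mul, intervalIntegral.integral_const_mul]
    · ring
    all_goals exact Continuous.intervalIntegrable (by fun_prop) _ _
  rw [← this]
  exact intervalIntegral.integral_nonneg hL fun x _ => sq_nonneg _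

variable {L : ℝ} {φ : ℝ × ℝ → ℝ}

theorem Per.continuous_x (h : Per L φ) (y : ℝ) : Continuous fun x => φ (x, y) :=
  h.continuous.comp (by fun_prop)

theorem Per.continuous_y (h : Per L φ) (x : ℝ) : Continuous fun y => φ (x, y) :=
  h.continuous.comp (by fun_prop)

theorem Per.exists_dx_eq_zero (h : Per L φ) (hL : 0 < L) (x y : ℝ) :
    ∃ r ∈ Ioo x (x + L), MKSE.dx φ (r, y) = 0 :=
  exists_hasDerivAt_eq_zero (by linarith) (h.continuous_x y).continuousOn (h.px x y).symm
    fun s _ => h.hasDerivAt_dx s y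

/-- One-dimensional Agmon inequality in the `x` direction. -/
theorem Per.dx_pow_four_le (h : Per L φ) (hL : 0 < L) (x y : ℝ) :
    MKSE.dx φ (x, y) ^ 4 ≤ (∫ s in 0..L, MKSE.dx φ (s, y) ^ 2)
      * ∫ s in 0..L, MKSE.dx (MKSE.dx φ) (s, y) ^ 2 := by
  obtain ⟨r, hr, hr0⟩ := h.exists_dx_eq_zero hL x y
  -- The oscillation bound is applied to the square of φ_x, compared with a zero supplied by Rolle;
  -- the factor 2 from differentiating the square cancels the half.
  have key := abs_sub_le_half_variation (L := L) (h := fun s => MKSE.dx φ (s, y) ^ 2)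
    (h' := fun s => 2 * (MKSE.dx φ (s, y) * MKSE.dx (MKSE.dx φ) (s, y)))
    (fun s => by convert! (h.dx.hasDerivAt_dx s y).pow 2 using 1; push_cast; ring)
    (continuous_const.mul ((h.dx.mul h.dx.dx).continuous_x y)) (fun s => by simp only [h.dx.px])
    hr.1.le hr.2.le
  simp only [hr0, ne_eq, OfNat.ofNat_ne_zero, not_false_eq_true, zero_pow, sub_zero,
    abs_of_nonneg (sq_nonneg (MKSE.dx φ (x, y))), abs_mul (2 : ℝ), abs_two,
    intervalIntegral.integral_const_mul] at key
  rw [mul_div_cancel_left₀ _ two_ne_zero] at key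
  calc MKSE.dx φ (x, y) ^ 4 = (MKSE.dx φ (x, y) ^ 2) ^ 2 := by ring
    _ ≤ _ := pow_le_pow_left₀ (sq_nonneg _) key 2
    _ ≤ _ := intervalIntegral_abs_mul_sq_le hL.le (h.dx.continuous_x y) (h.dx.dx.continuous_x y)

/-- Poincaré's inequality for `x`-derivatives. -/
theorem Per.avg_dx_sq_le (h : Per L φ) (hL : 0 < L) :
    avg L (fun p => MKSE.dx φ p ^ 2) ≤
      L ^ 2 / 4 * avg L (fun p => MKSE.dx (MKSE.dx φ) p ^ 2) := by
  have pt : ∀ x y, MKSE.dx φ (x, y) ^ 2 ≤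
      L / 4 * ∫ s in 0..L, MKSE.dx (MKSE.dx φ) (s, y) ^ 2 := fun x y => by
    obtain ⟨r, hr, hr0⟩ := h.exists_dx_eq_zero hL x y
    have key := abs_sub_le_half_variation (L := L) (h := fun s => MKSE.dx φ (s, y))
      (fun s => h.dx.hasDerivAt_dx s y) (h.dx.dx.continuous_x y) (fun s => h.dx.px s y)
      hr.1.le hr.2.le
    rw [hr0, sub_zero] at key
    -- Cauchy–Schwarz against 1 costs a factor L; with the squared half this gives L/4 pointwise and
    -- L²/4 after integration in x.
    have cs := intervalIntegral_abs_mul_sq_le hL.le (f := fun _ => 1) continuous_const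
      (h.dx.dx.continuous_x y)
    simp only [one_mul, one_pow, intervalIntegral.integral_const, sub_zero, smul_eq_mul,
      mul_one] at cs
    have k2 := pow_le_pow_left₀ (abs_nonneg _) key 2
    rw [sq_abs] at k2
    calc _ ≤ _ := k2
      _ ≤ _ := by linarith
  have hcy : Continuous fun y => ∫ s in 0..L, MKSE.dx (MKSE.dx φ) (s, y) ^ 2 :=
    intervalIntegral.continuous_parametric_intervalIntegral_of_continuous'
      (f := fun y s => MKSE.dx (MKSE.dx φ) (s, y) ^ 2)
      ((h.dx.dx.pow 2).continuous.comp continuous_swap) 0 L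
  rw [avg_eq_yx hL.le (h.dx.pow 2).continuous, avg_eq_yx hL.le (h.dx.dx.pow 2).continuous,
    ← intervalIntegral.integral_const_mul]
  refine intervalIntegral.integral_mono_on hL.le (Continuous.intervalIntegrable
    (intervalIntegral.continuous_parametric_intervalIntegral_of_continuous'
      (f := fun y s => MKSE.dx φ (s, y) ^ 2)
      ((h.dx.pow 2).continuous.comp continuous_swap) 0 L) _ _)
    ((hcy.const_mul _).intervalIntegrable _ _) fun y _ => ?_
  calc ∫ x in 0..L, MKSE.dx φ (x, y) ^ 2
      ≤ ∫ x in 0..L, L / 4 * ∫ s in 0..L, MKSE.dx (MKSE.dx φ) (s, y) ^ 2 :=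
        intervalIntegral.integral_mono_on hL.le
          (((h.dx.pow 2).continuous_x y).intervalIntegrable _ _) (by simp) fun x _ => pt x y
    _ = _ := by
        rw [intervalIntegral.integral_const, sub_zero, smul_eq_mul]; ring

/-- Trace inequality on horizontal lines. -/
theorem Per.integral_x_sq_le (h : Per L φ) (hL : 0 < L) (y : ℝ) :
    ∫ s in 0..L, φ (s, y) ^ 2 ≤ L⁻¹ * avg L (fun p => φ p ^ 2)
      + √(avg L (fun p => φ p ^ 2) * avg L (fun p => MKSE.dy φ p ^ 2)) := by
  have hcx : ∀ f : ℝ × ℝ → ℝ, Continuous f → Continuous fun x => ∫ s in 0..L, f (x, s) :=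
    fun f hf => intervalIntegral.continuous_parametric_intervalIntegral_of_continuous'
      (f := fun x s => f (x, s)) hf 0 L
  have hm : Continuous fun p => |φ p * MKSE.dy φ p| := (h.mul h.dy).continuous.abs
  have pt : ∀ x, φ (x, y) ^ 2 ≤ L⁻¹ * (∫ s in 0..L, φ (x, s) ^ 2)
      + ∫ s in 0..L, |φ (x, s) * MKSE.dy φ (x, s)| := fun x => by
    have key := le_average_add_half_variation hL (h := fun s => φ (x, s) ^ 2)
      (h' := fun s => 2 * (φ (x, s) * MKSE.dy φ (x, s)))
      (fun s => by convert! (h.hasDerivAt_dy x s).pow 2 using 1; push_cast; ring)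
      (continuous_const.mul ((h.mul h.dy).continuous_y x)) (fun s => by simp only [h.py]) y
    simp only [abs_mul (2 : ℝ), abs_two, intervalIntegral.integral_const_mul] at key
    rwa [mul_div_cancel_left₀ _ two_ne_zero] at key
  have h1 : ∫ s in 0..L, φ (s, y) ^ 2 ≤ L⁻¹ * avg L (fun p => φ p ^ 2)
      + avg L (fun p => |φ p * MKSE.dy φ p|) := by
    rw [avg_eq_xy hL.le (h.pow 2).continuous, avg_eq_xy hL.le hm,
      ← intervalIntegral.integral_const_mul, ← intervalIntegral.integral_add]
    · exact intervalIntegral.integral_mono_on hL.le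
        (((h.pow 2).continuous_x y).intervalIntegrable _ _)
        ((((hcx _ (h.pow 2).continuous).const_mul _).add (hcx _ hm)).intervalIntegrable _ _)
        fun x _ => pt x
    · exact ((hcx _ (h.pow 2).continuous).const_mul _).intervalIntegrable _ _
    · exact (hcx _ hm).intervalIntegrable _ _
  refine h1.trans (add_le_add le_rfl (Real.le_sqrt_of_sq_le ?_))
  have := avg_mul_sq_le (L := L) h.continuous.abs h.dy.continuous.abs
  simpa only [abs_mul, sq_abs] using this

/-- Here f, a, b, c, d, e are the L² norms of φ_x, φ_xx, φ_xy, φ_xxx, φ_xxy, Δφ_x. The halves coming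
from Poincaré are small enough for the quadratic form bounds `hg` and `hH` to absorb the cross
terms, so no constant is lost. -/
theorem agmon_algebra {f a b c d e g : ℝ} (hf : 0 ≤ f) (hc : 0 ≤ c)
    (hd : 0 ≤ d) (he : 0 ≤ e) (hg : a ^ 2 + b ^ 2 ≤ f * e) (hH : c ^ 2 + 2 * d ^ 2 ≤ e ^ 2)
    (hgg : g ≤ (f * (b + a / 2)) * (a * (d + c / 2))) : g ≤ f ^ 2 * e ^ 2 := by
  have h1 : a * (b + a / 2) ≤ f * e := by nlinarith [sq_nonneg (a - b), sq_nonneg b]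
  have h2 : d + c / 2 ≤ e := by
    refine abs_le_of_sq_le_sq' ?_ he |>.2
    nlinarith [sq_nonneg (c - 2 * d), sq_nonneg c]
  calc g ≤ _ := hgg
    _ = f * (a * (b + a / 2)) * (d + c / 2) := by ring
    _ ≤ f * (f * e) * e := by gcongr
    _ = _ := by ring

/-- Agmon's inequality for `x`-derivatives of periodic functions. -/
theorem Per.agmon_dx (h : Per L φ) (hL : 0 < L) (p : ℝ × ℝ) :
    MKSE.dx φ p ^ 4 ≤
      avg L (fun p => MKSE.dx φ p ^ 2) * avg L (fun p => MKSE.lap (MKSE.dx φ) p ^ 2) := by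
  obtain ⟨x, y⟩ := p
  have nn : ∀ f : ℝ × ℝ → ℝ, 0 ≤ avg L (fun p => f p ^ 2) := fun f =>
    avg_nonneg fun p => sq_nonneg _
  have key := h.dx_pow_four_le hL x y
  have t1 := h.dx.integral_x_sq_le hL y
  have t2 := h.dx.dx.integral_x_sq_le hL y
  have p1 := h.avg_dx_sq_le hL
  have p2 := h.dx.avg_dx_sq_le hL
  have hes := h.dx.avg_hessian hL.le
  have gr := h.dx.grad2_sq_le hL.le
  rw [grad2, avg_add (h.dx.dx.pow 2).continuous (h.dx.dy.pow 2).continuous] at gr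
  rw [← h.dx.dx_dy_comm] at t2
  -- The lower-order trace term L⁻¹A is turned by Poincaré's constant L²/4 into half a product of
  -- norms.
  have poin : ∀ A B : ℝ, 0 ≤ A → 0 ≤ B → A ≤ L ^ 2 / 4 * B → L⁻¹ * A ≤ √A * (√B / 2) := by
    intro A B hA hB hAB
    have : √A ≤ L / 2 * √B := by
      rw [← Real.sqrt_sq (by positivity : 0 ≤ L / 2), ← Real.sqrt_mul (by positivity)]
      exact Real.sqrt_le_sqrt (by linarith)
    calc L⁻¹ * A = √A * (L⁻¹ * √A) := by
          nth_rewrite 1 [← Real.mul_self_sqrt hA]; ring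
      _ ≤ √A * (L⁻¹ * (L / 2 * √B)) := by gcongr
      _ = _ := by field_simp
  have q1 := poin _ _ (nn _) (nn _) p1
  have q2 := poin _ _ (nn _) (nn _) p2
  rw [Real.sqrt_mul (nn _)] at t1 t2
  have ef := Real.sq_sqrt (nn (MKSE.dx φ))
  have ea := Real.sq_sqrt (nn (MKSE.dx (MKSE.dx φ)))
  have eb := Real.sq_sqrt (nn (MKSE.dy (MKSE.dx φ)))
  have ec := Real.sq_sqrt (nn (MKSE.dx (MKSE.dx (MKSE.dx φ))))
  have ed := Real.sq_sqrt (nn (MKSE.dx (MKSE.dy (MKSE.dx φ))))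
  have ee := Real.sq_sqrt (nn (MKSE.lap (MKSE.dx φ)))
  set f := √(avg L (fun p => MKSE.dx φ p ^ 2))
  set a := √(avg L (fun p => MKSE.dx (MKSE.dx φ) p ^ 2))
  set b := √(avg L (fun p => MKSE.dy (MKSE.dx φ) p ^ 2))
  set c := √(avg L (fun p => MKSE.dx (MKSE.dx (MKSE.dx φ)) p ^ 2))
  set d := √(avg L (fun p => MKSE.dx (MKSE.dy (MKSE.dx φ)) p ^ 2))
  set e := √(avg L (fun p => MKSE.lap (MKSE.dx φ) p ^ 2))
  rw [← ef, ← ee]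
  refine agmon_algebra (a := a) (b := b) (c := c) (d := d) (Real.sqrt_nonneg _)
    (Real.sqrt_nonneg _) (Real.sqrt_nonneg _) (Real.sqrt_nonneg _) ?_ ?_ (key.trans ?_)
  · refine abs_le_of_sq_le_sq' ?_ (by positivity) |>.2
    rw [mul_pow, ef, ee, ea, eb]
    exact gr
  · rw [ec, ed, ee, ← hes]
    linarith [nn (MKSE.dy (MKSE.dy (MKSE.dx φ)))]
  · refine mul_le_mul ?_ ?_ (intervalIntegral.integral_nonneg hL.le fun _ _ => sq_nonneg _)
      (by positivity)
    · linarith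
    · linarith

theorem Per.swap (h : Per L φ) : Per L (fun p => φ (p.2, p.1)) :=
  ⟨h.smooth.comp (contDiff_snd.prodMk contDiff_fst), fun x y => h.py y x, fun x y => h.px y x⟩

theorem lap_swap (φ : ℝ × ℝ → ℝ) (p : ℝ × ℝ) :
    lap (fun p => φ (p.2, p.1)) p = lap φ (p.2, p.1) := add_comm _ _

theorem Per.agmon_dy (h : Per L φ) (hL : 0 < L) (p : ℝ × ℝ) :
    MKSE.dy φ p ^ 4 ≤
      avg L (fun p => MKSE.dy φ p ^ 2) * avg L (fun p => MKSE.lap (MKSE.dy φ) p ^ 2) := by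
  have := h.swap.agmon_dx hL (p.2, p.1)
  have e : MKSE.dx (fun p => φ (p.2, p.1)) = fun p => MKSE.dy φ (p.2, p.1) := rfl
  rw [avg_swap (fun p => MKSE.dy φ p ^ 2), avg_swap (fun p => MKSE.lap (MKSE.dy φ) p ^ 2)]
  simpa only [e, lap_swap] using this

theorem Per.dx_lap (h : Per L φ) (p : ℝ × ℝ) :
    MKSE.lap (MKSE.dx φ) p = MKSE.dx (MKSE.lap φ) p := by
  have := dx_add h.dx.dx h.dy.dy p
  rw [MKSE.lap, ← h.dx_dy_comm, ← h.dy.dx_dy_comm]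
  exact this.symm

theorem Per.dy_lap (h : Per L φ) (p : ℝ × ℝ) :
    MKSE.lap (MKSE.dy φ) p = MKSE.dy (MKSE.lap φ) p := by
  have := dy_add h.dx.dx h.dy.dy p
  rw [MKSE.lap, h.dx_dy_comm, h.dx.dx_dy_comm]
  exact this.symm

/-- Cauchy–Schwarz in the plane for the vectors (√A, √C) and (√B, √D); it adds the two gradient
components without a factor 2. -/
theorem add_le_sqrt_of_sq_le {a b A B C D : ℝ} (hA : 0 ≤ A) (hB : 0 ≤ B) (hC : 0 ≤ C) (hD : 0 ≤ D)
    (h1 : a ^ 2 ≤ A * B) (h2 : b ^ 2 ≤ C * D) :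
    a + b ≤ √((A + C) * (B + D)) := by
  refine Real.le_sqrt_of_sq_le ?_
  have : 2 * (a * b) ≤ A * D + C * B := by
    refine abs_le_of_sq_le_sq' ?_ (by positivity) |>.2
    have h3 : a ^ 2 * b ^ 2 ≤ A * B * (C * D) := by gcongr
    nlinarith [sq_nonneg (A * D - C * B)]
  nlinarith

/-- Agmon's inequality for the gradient of a periodic function. -/
theorem Per.agmon_grad (h : Per L φ) (hL : 0 < L) (p : ℝ × ℝ) :
    MKSE.dx φ p ^ 2 + MKSE.dy φ p ^ 2 ≤ √(grad2 L φ * grad2 L (MKSE.lap φ)) := by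
  have nn : ∀ f : ℝ × ℝ → ℝ, 0 ≤ avg L (fun p => f p ^ 2) := fun f =>
    avg_nonneg fun p => sq_nonneg _
  have h1 := h.agmon_dx hL p
  have h2 := h.agmon_dy hL p
  rw [grad2, grad2, avg_add (h.dx.pow 2).continuous (h.dy.pow 2).continuous,
    avg_add (h.lap.dx.pow 2).continuous (h.lap.dy.pow 2).continuous]
  simp only [h.dx_lap, h.dy_lap] at h1 h2
  refine add_le_sqrt_of_sq_le (nn _) (nn _) (nn _) (nn _) ?_ ?_
  · rw [← pow_mul]; exact h1
  · rw [← pow_mul]; exact h2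

end MKSE

/-! ### Energy inequalities for u and for Δu. -/

namespace MKSE

variable {L lam : ℝ} {φ ψ : ℝ × ℝ → ℝ}

/-- The right-hand side of the modified Kuramoto–Sivashinsky equation. -/
noncomputable def rhs (lam : ℝ) (φ : ℝ × ℝ → ℝ) (p : ℝ × ℝ) : ℝ :=
  -lap (lap φ) p - lap φ p + lam * φ p - φ p ^ 3 - φ p * (dx φ p + dy φ p)

theorem Per.avg_mul_rhs (h : Per L φ) (k : Per L ψ) (lam : ℝ) :
    avg L (fun p => ψ p * rhs lam φ p) =
      -avg L (fun p => ψ p * MKSE.lap (MKSE.lap φ) p) - avg L (fun p => ψ p * MKSE.lap φ p)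
        + lam * avg L (fun p => ψ p * φ p) - avg L (fun p => ψ p * φ p ^ 3)
        - avg L (fun p => ψ p * (φ p * (MKSE.dx φ p + MKSE.dy φ p))) := by
  have p1 := (k.mul h.lap.lap).neg
  have p2 := k.mul h.lap
  have p3 := (k.mul h).const_mul lam
  have p4 := k.mul (h.pow 3)
  have p5 := k.mul (h.mul (h.dx.add h.dy))
  rw [← avg_const_mul, ← avg_neg, ← avg_sub p1.continuous p2.continuous,
    ← avg_add (p1.sub p2).continuous p3.continuous,
    ← avg_sub ((p1.sub p2).add p3).continuous p4.continuous,
    ← avg_sub (((p1.sub p2).add p3).sub p4).continuous p5.continuous]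
  exact avg_congr fun p => by rw [rhs]; ring

theorem Per.grad2_lap_eq (h : Per L φ) (hL : 0 ≤ L) :
    grad2 L (MKSE.lap φ) = -avg L (fun p => MKSE.lap (MKSE.lap φ) p * MKSE.lap φ p) := by
  rw [h.lap.grad2_eq hL]
  exact congrArg _ (avg_congr fun p => mul_comm _ _)

/-- The basic energy inequality. -/
theorem Per.energy_le (h : Per L φ) (hL : 0 < L) (lam : ℝ) :
    avg L (fun p => φ p * rhs lam φ p) ≤ (lam + 1 / 4) * avg L (fun p => φ p ^ 2)
      - avg L (fun p => φ p ^ 2) ^ 2 / L ^ 2 := by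
  rw [h.avg_mul_rhs h]
  have e1 : avg L (fun p => φ p * MKSE.lap (MKSE.lap φ) p) = avg L (fun p => MKSE.lap φ p ^ 2) := by
    rw [avg_mul_lap_comm h h.lap hL.le]
    exact avg_congr fun p => (sq _).symm
  have e2 := h.grad2_eq hL.le
  have e3 : avg L (fun p => φ p * φ p) = avg L (fun p => φ p ^ 2) := avg_congr fun p => (sq _).symm
  have e4 : avg L (fun p => φ p * φ p ^ 3) = avg L (fun p => (φ p ^ 2) ^ 2) :=
    avg_congr fun p => by ring
  -- The integrand is one third of ∂_x(φ³) + ∂_y(φ³), which integrates to zero.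
  have e5 : avg L (fun p => φ p * (φ p * (MKSE.dx φ p + MKSE.dy φ p))) = 0 := by
    have hx := (h.pow 3).avg_dx hL.le
    have hy := (h.pow 3).avg_dy hL.le
    have : 3 * avg L (fun p => φ p * (φ p * (MKSE.dx φ p + MKSE.dy φ p))) = 0 := by
      rw [← avg_const_mul, ← add_zero (0 : ℝ)]
      nth_rewrite 1 [← hx]
      nth_rewrite 1 [← hy]
      rw [← avg_add (h.pow 3).dx.continuous (h.pow 3).dy.continuous]
      refine avg_congr fun p => ?_
      rw [dx_pow h, dy_pow h]
      push_cast
      ring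
    linarith
  have e6 : avg L (fun p => φ p ^ 2) ^ 2 / L ^ 2 ≤ avg L (fun p => (φ p ^ 2) ^ 2) := by
    have := avg_mul_sq_le (L := L) (h.pow 2).continuous (continuous_const (y := (1 : ℝ)))
    rw [avg_const hL.le] at this
    simp only [mul_one, one_pow] at this
    rwa [div_le_iff₀ (by positivity)]
  have e7 := h.grad2_sq_le hL.le
  -- From A1² ≤ A0 A2 and the arithmetic-geometric mean inequality; this is the source of the 1/4 in
  -- λ + 1/4.
  have e8 : grad2 L φ ≤ avg L (fun p => MKSE.lap φ p ^ 2) + avg L (fun p => φ p ^ 2) / 4 := by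
    have n0 : 0 ≤ avg L (fun p => φ p ^ 2) := avg_nonneg fun p => sq_nonneg _
    have n2 : 0 ≤ avg L (fun p => MKSE.lap φ p ^ 2) := avg_nonneg fun p => sq_nonneg _
    refine abs_le_of_sq_le_sq' ?_ (by positivity) |>.2
    nlinarith [sq_nonneg (avg L (fun p => MKSE.lap φ p ^ 2) - avg L (fun p => φ p ^ 2) / 4)]
  rw [e1, e3, e4, e5]
  linarith

theorem Per.lap_cube (h : Per L φ) (p : ℝ × ℝ) :
    MKSE.lap (fun p => φ p ^ 3) p =
      3 * φ p ^ 2 * MKSE.lap φ p + 6 * φ p * (MKSE.dx φ p ^ 2 + MKSE.dy φ p ^ 2) := by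
  have ex : MKSE.dx (fun p => φ p ^ 3) = fun p => (3 * φ p ^ 2) * MKSE.dx φ p := by
    ext p; rw [dx_pow h]; push_cast; ring
  have ey : MKSE.dy (fun p => φ p ^ 3) = fun p => (3 * φ p ^ 2) * MKSE.dy φ p := by
    ext p; rw [dy_pow h]; push_cast; ring
  have hc : Per L (fun p => 3 * φ p ^ 2) := (h.pow 2).const_mul 3
  have dx3 : MKSE.dx (fun p => 3 * φ p ^ 2) p = 6 * φ p * MKSE.dx φ p := by
    rw [dx_mul (Per.const 3) (h.pow 2), dx_pow h]
    simp only [MKSE.dx, deriv_const]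
    push_cast; ring
  have dy3 : MKSE.dy (fun p => 3 * φ p ^ 2) p = 6 * φ p * MKSE.dy φ p := by
    rw [dy_mul (Per.const 3) (h.pow 2), dy_pow h]
    simp only [MKSE.dy, deriv_const]
    push_cast; ring
  rw [MKSE.lap, ex, ey, dx_mul hc h.dx, dy_mul hc h.dy, dx3, dy3, MKSE.lap]
  ring

/-- The energy inequality for the Laplacian. -/
theorem Per.lap_energy_le (h : Per L φ) (hL : 0 < L) (lam : ℝ) {M : ℝ}
    (hM : ∀ p, MKSE.dx φ p ^ 2 + MKSE.dy φ p ^ 2 ≤ M) :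
    avg L (fun p => MKSE.lap (MKSE.lap φ) p * rhs lam φ p) ≤
      -avg L (fun p => MKSE.lap (MKSE.lap φ) p ^ 2) + grad2 L (MKSE.lap φ)
        + lam * avg L (fun p => MKSE.lap φ p ^ 2) + 3 * (M * grad2 L φ)
        + √(avg L (fun p => MKSE.lap (MKSE.lap φ) p ^ 2)
          * (2 * M * avg L (fun p => φ p ^ 2))) := by
  rw [h.avg_mul_rhs h.lap.lap]
  have e1 : avg L (fun p => MKSE.lap (MKSE.lap φ) p * MKSE.lap (MKSE.lap φ) p) =
      avg L (fun p => MKSE.lap (MKSE.lap φ) p ^ 2) := avg_congr fun p => (sq _).symm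
  have e2 := h.grad2_lap_eq hL.le
  have e3 : avg L (fun p => MKSE.lap (MKSE.lap φ) p * φ p) = avg L (fun p => MKSE.lap φ p ^ 2) := by
    rw [← avg_mul_lap_comm h.lap h hL.le]
    exact avg_congr fun p => (sq _).symm
  have cg : Continuous fun p => MKSE.dx φ p ^ 2 + MKSE.dy φ p ^ 2 :=
    ((h.dx.pow 2).add (h.dy.pow 2)).continuous
  -- With g = |∇φ|², -Δφ Δ(φ³) = -3φ²(Δφ)² - 6φ Δφ g = -3(φΔφ + g)² + 3g². The square is dropped and
  -- g² ≤ M g.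
  have e4 : -avg L (fun p => MKSE.lap (MKSE.lap φ) p * φ p ^ 3) ≤ 3 * (M * grad2 L φ) := by
    rw [← avg_mul_lap_comm h.lap (h.pow 3) hL.le, ← avg_neg, grad2, ← avg_const_mul,
      ← avg_const_mul]
    refine avg_mono (h.lap.mul (h.pow 3).lap).neg.continuous
      (continuous_const.mul (continuous_const.mul cg)) fun p => ?_
    rw [h.lap_cube]
    have h0 : 0 ≤ MKSE.dx φ p ^ 2 + MKSE.dy φ p ^ 2 := by positivity
    nlinarith [sq_nonneg (φ p * MKSE.lap φ p + (MKSE.dx φ p ^ 2 + MKSE.dy φ p ^ 2)),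
      mul_le_mul_of_nonneg_right (hM p) h0]
  -- Cauchy–Schwarz, followed by (φ_x + φ_y)² ≤ 2|∇φ|² ≤ 2M.
  have e5 : -avg L (fun p => MKSE.lap (MKSE.lap φ) p * (φ p * (MKSE.dx φ p + MKSE.dy φ p))) ≤
      √(avg L (fun p => MKSE.lap (MKSE.lap φ) p ^ 2) * (2 * M * avg L (fun p => φ p ^ 2))) := by
    have hD := h.mul (h.dx.add h.dy)
    refine Real.le_sqrt_of_sq_le ?_
    rw [neg_sq]
    refine (avg_mul_sq_le h.lap.lap.continuous hD.continuous).trans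
      (mul_le_mul_of_nonneg_left ?_ (avg_nonneg fun p => sq_nonneg _))
    rw [← avg_const_mul]
    refine avg_mono (hD.pow 2).continuous ((h.pow 2).const_mul _).continuous fun p => ?_
    rw [mul_pow, mul_comm]
    refine mul_le_mul_of_nonneg_right ?_ (sq_nonneg _)
    nlinarith [hM p, sq_nonneg (MKSE.dx φ p - MKSE.dy φ p)]
  rw [e1, e3]
  linarith

/-- The ladder inequality, with the gradient eliminated by Agmon's inequality. -/
theorem Per.ladder (h : Per L φ) (hL : 0 < L) (lam : ℝ) :
    avg L (fun p => MKSE.lap (MKSE.lap φ) p * rhs lam φ p) ≤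
      -avg L (fun p => MKSE.lap (MKSE.lap φ) p ^ 2) + grad2 L (MKSE.lap φ)
        + lam * avg L (fun p => MKSE.lap φ p ^ 2)
        + 3 * (√(grad2 L φ * grad2 L (MKSE.lap φ)) * grad2 L φ)
        + √(avg L (fun p => MKSE.lap (MKSE.lap φ) p ^ 2)
          * (2 * √(grad2 L φ * grad2 L (MKSE.lap φ)) * avg L (fun p => φ p ^ 2))) :=
  h.lap_energy_le hL lam (h.agmon_grad hL)

end MKSE

/-! ### Scalar comparison and the algebra of the ladder inequality. -/

namespace MKSE

/-- Staying above M would force a linear decrease, reaching M by time T + 1 + (y(T+1) - M)/η. Once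
at or below M, the level is a barrier because the derivative is negative there. -/
theorem eventually_le_of_deriv_le_neg {y y' : ℝ → ℝ} {M η T : ℝ} (hη : 0 < η)
    (hd : ∀ t, T < t → HasDerivAt y (y' t) t) (hneg : ∀ t, T < t → M ≤ y t → y' t ≤ -η) :
    ∀ᶠ t in atTop, y t ≤ M := by
  have h1 : ∃ t, T < t ∧ y t ≤ M := by
    by_contra! hcon
    have hanti : ∀ t, T + 1 < t → y t ≤ y (T + 1) - η * (t - (T + 1)) := fun t ht => by
      obtain ⟨c, hc, hc'⟩ := exists_hasDerivAt_eq_slope y y' ht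
        (fun s hs => (hd s (by linarith [hs.1])).continuousAt.continuousWithinAt)
        (fun s hs => hd s (by linarith [hs.1]))
      have hcT : T < c := by linarith [hc.1]
      have h2 := hneg c hcT (hcon c hcT).le
      rw [hc', div_le_iff₀ (by linarith)] at h2
      linarith
    have hy1 := hcon (T + 1) (by linarith)
    have ht : T + 1 < T + 1 + (y (T + 1) - M) / η := by
      have : 0 < (y (T + 1) - M) / η := div_pos (by linarith) hη
      linarith
    have h3 := hanti _ ht
    rw [add_sub_cancel_left, mul_div_cancel₀ _ hη.ne'] at h3
    linarith [hcon _ (by linarith : T < T + 1 + (y (T + 1) - M) / η)]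
  obtain ⟨t₁, ht₁, hy₁⟩ := h1
  filter_upwards [eventually_ge_atTop t₁] with t ht
  exact image_le_of_deriv_right_lt_deriv_boundary (f := y) (f' := y') (a := t₁) (b := t)
    (B := fun _ => M) (B' := fun _ => 0)
    (fun s hs => (hd s (ht₁.trans_le hs.1)).continuousAt.continuousWithinAt)
    (fun s hs => (hd s (ht₁.trans_le hs.1)).hasDerivWithinAt) hy₁
    (fun s => hasDerivAt_const s M)
    (fun s hs he => (hneg s (ht₁.trans_le hs.1) he.ge).trans_lt (by linarith)) ⟨ht, le_rfl⟩

theorem limsup_ofReal_le_of_forall_gt {y : ℝ → ℝ} {M : ℝ}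
    (h : ∀ M', M < M' → ∀ᶠ t in atTop, y t ≤ M') :
    limsup (fun t => ENNReal.ofReal (y t)) atTop ≤ ENNReal.ofReal M := by
  have h1 : ∀ n : ℕ, limsup (fun t => ENNReal.ofReal (y t)) atTop
      ≤ ENNReal.ofReal (M + 1 / ((n : ℝ) + 1)) := fun n =>
    limsup_le_of_le (h := (h _ (by linarith [Nat.one_div_pos_of_nat (α := ℝ) (n := n)])).mono
      fun t ht => ENNReal.ofReal_le_ofReal ht)
  refine ge_of_tendsto' (x := atTop) ?_ h1
  refine (ENNReal.continuous_ofReal.tendsto M).comp ?_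
  simpa using (tendsto_const_nhds (x := M)).add tendsto_one_div_add_atTop_nhds_zero_nat

/-- A weighted Young inequality with exponents `4/3` and `4`. -/
theorem young_quartic {k y z : ℝ} (hk : 0 ≤ k) (hy : 0 ≤ y) (hz : 0 ≤ z) :
    k * (y ^ 3 * z) ≤ y ^ 4 + 27 / 256 * k ^ 4 * z ^ 4 := by
  -- The difference of the two sides has a double root at y = 3kz/4, its minimum; this fixes the
  -- constant 27/256.
  have : 0 ≤ (y - 3 * k / 4 * z) ^ 2 * (y ^ 2 + k / 2 * (y * z) + 3 * k ^ 2 / 16 * z ^ 2) := by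
    positivity
  linarith [this, show y ^ 4 + 27 / 256 * k ^ 4 * z ^ 4 - k * (y ^ 3 * z) =
    (y - 3 * k / 4 * z) ^ 2 * (y ^ 2 + k / 2 * (y * z) + 3 * k ^ 2 / 16 * z ^ 2) by ring]

section Algebra

variable {A0 A1 A2 A3 A4 : ℝ}

/-- With x⁴ = A0 and y⁴ = A4, interpolation gives A1 ≤ x³y, A2 ≤ x²y², A3 ≤ xy³. Except for A2,
every bad term is then y³ times a power of x, ready for Young's inequality. The factor 3/2 is a
rational bound for √2. -/
theorem ladder_roots (h0 : 0 ≤ A0) (h1 : 0 ≤ A1) (h3 : 0 ≤ A3) (h4 : 0 ≤ A4)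
    (i1 : A1 ^ 2 ≤ A0 * A2) (i2 : A2 ^ 2 ≤ A0 * A4) (i3 : A3 ^ 2 ≤ A2 * A4) :
    ∃ x y : ℝ, 0 ≤ x ∧ 0 ≤ y ∧ x ^ 4 = A0 ∧ y ^ 4 = A4 ∧ A2 ≤ x ^ 2 * y ^ 2 ∧ A3 ≤ y ^ 3 * x ∧
      √(A1 * A3) * A1 ≤ y ^ 3 * x ^ 5 ∧
      √(A4 * (2 * √(A1 * A3) * A0)) ≤ y ^ 3 * (3 / 2 * x ^ 3) := by
  have root : ∀ a : ℝ, 0 ≤ a → √√a ^ 4 = a := fun a ha => by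
    rw [show √√a ^ 4 = (√√a ^ 2) ^ 2 by ring, Real.sq_sqrt (Real.sqrt_nonneg _), Real.sq_sqrt ha]
  obtain ⟨x, hx, rfl⟩ : ∃ x : ℝ, 0 ≤ x ∧ x ^ 4 = A0 := ⟨_, Real.sqrt_nonneg _, root _ h0⟩
  obtain ⟨y, hy, rfl⟩ : ∃ y : ℝ, 0 ≤ y ∧ y ^ 4 = A4 := ⟨_, Real.sqrt_nonneg _, root _ h4⟩
  have j2 : A2 ≤ x ^ 2 * y ^ 2 := by
    refine abs_le_of_sq_le_sq' ?_ (by positivity) |>.2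
    calc A2 ^ 2 ≤ _ := i2
      _ = _ := by ring
  have j1 : A1 ≤ x ^ 3 * y := by
    refine abs_le_of_sq_le_sq' ?_ (by positivity) |>.2
    calc A1 ^ 2 ≤ x ^ 4 * A2 := i1
      _ ≤ x ^ 4 * (x ^ 2 * y ^ 2) := by gcongr
      _ = _ := by ring
  have j3 : A3 ≤ y ^ 3 * x := by
    refine abs_le_of_sq_le_sq' ?_ (by positivity) |>.2
    calc A3 ^ 2 ≤ A2 * y ^ 4 := i3
      _ ≤ (x ^ 2 * y ^ 2) * y ^ 4 := by gcongr
      _ = _ := by ring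
  have j13 : √(A1 * A3) ≤ x ^ 2 * y ^ 2 := by
    refine (Real.sqrt_le_left (by positivity)).2 ?_
    calc A1 * A3 ≤ (x ^ 3 * y) * (y ^ 3 * x) := by gcongr
      _ = _ := by ring
  refine ⟨x, y, hx, hy, rfl, rfl, j2, j3, ?_, ?_⟩
  · calc √(A1 * A3) * A1 ≤ (x ^ 2 * y ^ 2) * (x ^ 3 * y) := by gcongr
      _ = _ := by ring
  · refine (Real.sqrt_le_left (by positivity)).2 ?_
    calc y ^ 4 * (2 * √(A1 * A3) * x ^ 4) ≤ y ^ 4 * (2 * (x ^ 2 * y ^ 2) * x ^ 4) := by gcongr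
      _ = 2 * (y ^ 6 * x ^ 6) := by ring
      _ ≤ 9 / 4 * (y ^ 6 * x ^ 6) := by
        have : 0 ≤ y ^ 6 * x ^ 6 := by positivity
        linarith
      _ = _ := by ring

/-- The real-valued version of `bracket`. -/
noncomputable def bracketReal (lam a : ℝ) : ℝ :=
  108 + 4 * lam ^ 2 + 108 * (5 / √Real.pi) ^ 4 * a ^ 2 + 108 * (78 / Real.pi) ^ 4 * a ^ 4

theorem bracketReal_pos (lam a : ℝ) : 0 < bracketReal lam a := by
  unfold bracketReal; positivity

theorem bracketReal_mono (lam : ℝ) {a b : ℝ} (ha : 0 ≤ a) (hab : a ≤ b) :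
    bracketReal lam a ≤ bracketReal lam b := by
  unfold bracketReal; gcongr

theorem continuous_bracketReal (lam : ℝ) : Continuous (bracketReal lam) := by
  unfold bracketReal; fun_prop

theorem sixteen_le_pi_const : 16 ≤ (5 / √Real.pi) ^ 4 := by
  have h1 : √Real.pi ^ 4 = Real.pi ^ 2 := by
    rw [show √Real.pi ^ 4 = (√Real.pi ^ 2) ^ 2 by ring, Real.sq_sqrt Real.pi_pos.le]
  rw [div_pow, h1, le_div_iff₀ (by positivity)]
  nlinarith [Real.pi_lt_four, Real.pi_pos]

theorem pi_const_lower : (19 : ℝ) ^ 4 ≤ (78 / Real.pi) ^ 4 := by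
  gcongr
  rw [le_div_iff₀ Real.pi_pos]
  linarith [Real.pi_lt_four]

/-- Three Young inequalities with k = 6 cost A4/6 each and the λ term costs A4/4, which leaves
-A4/4. The remainders fit under the constants of the bracket with room to spare: 27·6³/256 < 27 for
the linear one. -/
theorem ladder_le_bracket (lam : ℝ) (h0 : 0 ≤ A0) (h1 : 0 ≤ A1) (h3 : 0 ≤ A3) (h4 : 0 ≤ A4)
    (hlam : 0 ≤ lam)
    (i1 : A1 ^ 2 ≤ A0 * A2) (i2 : A2 ^ 2 ≤ A0 * A4) (i3 : A3 ^ 2 ≤ A2 * A4) :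
    -A4 + A3 + lam * A2 + 3 * (√(A1 * A3) * A1) + √(A4 * (2 * √(A1 * A3) * A0)) ≤
      -A4 / 4 + bracketReal lam A0 * A0 / 4 := by
  obtain ⟨x, y, hx, hy, rfl, rfl, j2, j3, jc, jv⟩ := ladder_roots h0 h1 h3 h4 i1 i2 i3
  have y3 := young_quartic (k := 6) (by norm_num) hy hx
  have yc := young_quartic (k := 6) (by norm_num) hy (by positivity : 0 ≤ 3 * x ^ 5)
  have yv := young_quartic (k := 6) (by norm_num) hy (by positivity : 0 ≤ 3 / 2 * x ^ 3)
  have yl : lam * A2 ≤ y ^ 4 / 4 + lam ^ 2 * x ^ 4 := by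
    have := mul_le_mul_of_nonneg_left j2 hlam
    nlinarith [sq_nonneg (y ^ 2 / 2 - lam * x ^ 2)]
  have b1 := mul_le_mul_of_nonneg_right sixteen_le_pi_const (by positivity : 0 ≤ x ^ 12)
  have b2 := mul_le_mul_of_nonneg_right pi_const_lower (by positivity : 0 ≤ x ^ 20)
  have n1 : 0 ≤ x ^ 4 := by positivity
  have n2 : 0 ≤ x ^ 12 := by positivity
  have n3 : 0 ≤ x ^ 20 := by positivity
  have e : bracketReal lam (x ^ 4) * x ^ 4 / 4 = 27 * x ^ 4 + lam ^ 2 * x ^ 4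
      + 27 * ((5 / √Real.pi) ^ 4 * x ^ 12) + 27 * ((78 / Real.pi) ^ 4 * x ^ 20) := by
    unfold bracketReal; ring
  rw [e]
  have ec : (3 * x ^ 5) ^ 4 = 81 * x ^ 20 := by ring
  have ev : (3 / 2 * x ^ 3) ^ 4 = 81 / 16 * x ^ 12 := by ring
  rw [ec] at yc
  rw [ev] at yv
  linarith

/-- With Poincaré's inequality the linear terms can be absorbed. -/
theorem ladder_le_of_poincare {lam κ : ℝ} (h0 : 0 ≤ A0) (h1 : 0 ≤ A1) (h3 : 0 ≤ A3)
    (h4 : 0 ≤ A4) (hlam : 0 ≤ lam) (hκ : 0 ≤ κ) (hlin : κ + lam * κ ^ 2 ≤ 39 / 50)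
    (i1 : A1 ^ 2 ≤ A0 * A2) (i2 : A2 ^ 2 ≤ A0 * A4) (i3 : A3 ^ 2 ≤ A2 * A4)
    (hp : A2 ≤ κ ^ 2 * A4) :
    -A4 + A3 + lam * A2 + 3 * (√(A1 * A3) * A1) + √(A4 * (2 * √(A1 * A3) * A0)) ≤
      -A4 / 14 + 290 * (6 * A0 ^ 2 + 81 * A0 ^ 4) * A0 := by
  have k3 : A3 ≤ κ * A4 := by
    refine abs_le_of_sq_le_sq' ?_ (by positivity) |>.2
    calc A3 ^ 2 ≤ A2 * A4 := i3
      _ ≤ κ ^ 2 * A4 * A4 := by gcongr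
      _ = _ := by ring
  obtain ⟨x, y, hx, hy, rfl, rfl, j2, j3, jc, jv⟩ := ladder_roots h0 h1 h3 h4 i1 i2 i3
  -- The linear terms use at most 39/50 of A4. Two Young inequalities with k = 14 use 1/7, so at
  -- least 1/14 remains; 290 rounds up 27·14³/256.
  have yc := young_quartic (k := 14) (by norm_num) hy (by positivity : 0 ≤ 3 * x ^ 5)
  have yv := young_quartic (k := 14) (by norm_num) hy (by positivity : 0 ≤ 3 / 2 * x ^ 3)
  have yl := mul_le_mul_of_nonneg_left hp hlam
  have yl' := mul_le_mul_of_nonneg_right hlin h4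
  have n2 : 0 ≤ x ^ 12 := by positivity
  have n3 : 0 ≤ x ^ 20 := by positivity
  have ec : (3 * x ^ 5) ^ 4 = 81 * x ^ 20 := by ring
  have ev : (3 / 2 * x ^ 3) ^ 4 = 81 / 16 * x ^ 12 := by ring
  rw [ec] at yc
  rw [ev] at yv
  have e : 290 * (6 * (x ^ 4) ^ 2 + 81 * (x ^ 4) ^ 4) * x ^ 4 = 1740 * x ^ 12
    + 23490 * x ^ 20 := by ring
  rw [e]
  linarith

/-- For small amplitudes Poincaré's inequality also absorbs the nonlinear terms. -/
theorem ladder_le_of_small {lam κ : ℝ} (h0 : 0 ≤ A0) (h1 : 0 ≤ A1) (h2 : 0 ≤ A2) (h3 : 0 ≤ A3)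
    (h4 : 0 ≤ A4) (hlam : 0 ≤ lam) (hκ : 0 ≤ κ) (hκ' : κ ≤ 1 / 9) (hlin : lam * κ ^ 2 ≤ 1 / 100)
    (hA : A0 ≤ 6 / 5)
    (i0 : A1 ≤ κ * A2) (i1 : A1 ^ 2 ≤ A0 * A2) (i2 : A2 ^ 2 ≤ A0 * A4) (i3 : A3 ^ 2 ≤ A2 * A4)
    (hp : A2 ≤ κ ^ 2 * A4) :
    -A4 + A3 + lam * A2 + 3 * (√(A1 * A3) * A1) + √(A4 * (2 * √(A1 * A3) * A0)) ≤
      -A4 / 4 := by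
  have k3 : A3 ≤ κ * A4 := by
    refine abs_le_of_sq_le_sq' ?_ (by positivity) |>.2
    calc A3 ^ 2 ≤ A2 * A4 := i3
      _ ≤ κ ^ 2 * A4 * A4 := by gcongr
      _ = _ := by ring
  have k13 : √(A1 * A3) ≤ κ ^ 2 * A4 := by
    refine (Real.sqrt_le_left (by positivity)).2 ?_
    calc A1 * A3 ≤ (κ * (κ ^ 2 * A4)) * (κ * A4) := by gcongr; exact i0.trans (by gcongr)
      _ = _ := by ring
  -- One factor A1² is estimated by A0 A2 instead of Poincaré, so that the bound is linear in A4
  -- with the small factor A0 κ.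
  have kc : √(A1 * A3) * A1 ≤ A0 * (κ * A4) := by
    rw [← Real.sqrt_sq h1, ← Real.sqrt_mul' _ (sq_nonneg _), Real.sqrt_sq h1]
    refine (Real.sqrt_le_left (by positivity)).2 ?_
    calc A1 * A3 * A1 ^ 2 ≤ (κ * A2) * (κ * A4) * (A0 * A2) := by gcongr
      _ = κ ^ 2 * A4 * A0 * A2 ^ 2 := by ring
      _ ≤ κ ^ 2 * A4 * A0 * (A0 * A4) := by gcongr
      _ = _ := by ring
  have kv : √(A4 * (2 * √(A1 * A3) * A0)) ≤ 8 / 5 * (κ * A4) := by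
    refine (Real.sqrt_le_left (by positivity)).2 ?_
    calc A4 * (2 * √(A1 * A3) * A0) ≤ A4 * (2 * (κ ^ 2 * A4) * (6 / 5)) := by gcongr
      _ = 12 / 5 * (κ * A4) ^ 2 := by ring
      _ ≤ 64 / 25 * (κ * A4) ^ 2 := mul_le_mul_of_nonneg_right (by norm_num) (sq_nonneg _)
      _ = _ := by ring
  have kc' : A0 * (κ * A4) ≤ 6 / 5 * (κ * A4) := by gcongr
  have kk : κ * A4 ≤ 1 / 9 * A4 := by gcongr
  -- The final budget is 1/9 + 1/100 + 3·(6/5)/9 + (8/5)/9 < 3/4.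
  have yl := mul_le_mul_of_nonneg_left hp hlam
  have yl' := mul_le_mul_of_nonneg_right hlin h4
  linarith

end Algebra

end MKSE

/-! ### Jacobi's two-square theorem by recursion over Gaussian primes. -/

namespace MKSE

open ZMod GaussianInt

/-- The number of Gaussian integers of norm `n`. -/
noncomputable def normCount (n : ℤ) : ℕ := {z : GaussianInt | z.norm = n}.ncard

theorem gaussianInt_norm_eq (z : GaussianInt) : z.norm = z.re ^ 2 + z.im ^ 2 := by
  rw [Zsqrtd.norm_def]; ring

theorem finite_norm_eq (n : ℤ) : {z : GaussianInt | z.norm = n}.Finite := by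
  refine (((Set.finite_Icc (-n) n).prod (Set.finite_Icc (-n) n)).image
    fun p : ℤ × ℤ => (⟨p.1, p.2⟩ : GaussianInt)).subset fun z hz => ?_
  have h : z.re ^ 2 + z.im ^ 2 = n := (gaussianInt_norm_eq z).symm.trans hz
  have hb : ∀ a b : ℤ, a ^ 2 + b ^ 2 = n → a ∈ Icc (-n) n := fun a b hab => by
    have := sq_nonneg b
    have h1 := Int.le_self_sq a
    have h2 := Int.le_self_sq (-a)
    rw [neg_sq] at h2
    exact ⟨by linarith, by linarith⟩
  exact ⟨(z.re, z.im), ⟨hb _ _ h, hb z.im z.re (by linarith)⟩, rfl⟩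

theorem ncard_dvd_norm_eq {a : GaussianInt} (ha : a ≠ 0) (m : ℤ) :
    {z : GaussianInt | a ∣ z ∧ z.norm = a.norm * m}.ncard = normCount m := by
  have : {z : GaussianInt | a ∣ z ∧ z.norm = a.norm * m} =
      (fun w => a * w) '' {z : GaussianInt | z.norm = m} := by
    ext z
    constructor
    · rintro ⟨⟨w, rfl⟩, hw⟩
      rw [Zsqrtd.norm_mul] at hw
      exact ⟨w, mul_left_cancel₀ (norm_pos.2 ha).ne' hw, rfl⟩
    · rintro ⟨w, hw, rfl⟩
      exact ⟨dvd_mul_right a w, by rw [Zsqrtd.norm_mul, hw]⟩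
  rw [this, Set.ncard_image_of_injective _ (mul_right_injective₀ ha), normCount]

theorem ncard_natCast_dvd_norm_eq {p : ℕ} (hp : p ≠ 0) (m : ℕ) :
    {z : GaussianInt | (p : GaussianInt) ∣ z ∧ z.norm = p * m}.ncard =
      if p ∣ m then normCount ((m / p : ℕ) : ℤ) else 0 := by
  split_ifs with h
  · obtain ⟨k, rfl⟩ := h
    rw [Nat.mul_div_cancel_left k (Nat.pos_of_ne_zero hp),
      ← ncard_dvd_norm_eq (Nat.cast_ne_zero.2 hp : (p : GaussianInt) ≠ 0)]
    congr 1
    ext z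
    simp only [mem_ofPred_eq, Zsqrtd.norm_natCast, Nat.cast_mul, mul_assoc]
  · rw [Set.ncard_eq_zero ((finite_norm_eq (p * m)).subset fun z hz => hz.2)]
    refine Set.eq_empty_of_forall_notMem ?_
    rintro z ⟨⟨w, rfl⟩, hw⟩
    rw [Zsqrtd.norm_mul, Zsqrtd.norm_natCast, mul_assoc] at hw
    have := mul_left_cancel₀ (Nat.cast_ne_zero.2 hp : (p : ℤ) ≠ 0) hw
    exact h (Int.natCast_dvd_natCast.1 ⟨_, this.symm⟩)

theorem prime_of_norm_prime {a : GaussianInt} {p : ℕ} (hp : p.Prime) (ha : a.norm = p) :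
    Prime a := by
  refine irreducible_iff_prime.1 ⟨fun hu => ?_, fun b c hbc => ?_⟩
  · rw [← Zsqrtd.norm_eq_one_iff, ha, Int.natAbs_natCast] at hu
    exact hp.ne_one hu
  · have h : b.norm.natAbs * c.norm.natAbs = p := by
      rw [← Int.natAbs_mul, ← Zsqrtd.norm_mul, ← hbc, ha, Int.natAbs_natCast]
    rw [← Zsqrtd.norm_eq_one_iff, ← Zsqrtd.norm_eq_one_iff]
    rcases (Nat.dvd_prime hp).1 ⟨_, h.symm⟩ with h1 | h1
    · exact Or.inl h1
    · refine Or.inr (Nat.eq_of_mul_eq_mul_left hp.pos ?_)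
      rw [h1] at h
      rw [h, mul_one]

theorem dvd_or_star_dvd {a z : GaussianInt} (ha : Prime a) (h : a ∣ (z.norm : GaussianInt)) :
    a ∣ z ∨ star a ∣ z := by
  rw [Zsqrtd.norm_eq_mul_conj] at h
  refine (ha.dvd_or_dvd h).imp_right fun ⟨w, hw⟩ => ⟨star w, ?_⟩
  rw [← star_star z, hw, star_mul']

theorem natCast_dvd_of_norm_eq {p m : ℕ} {a z : GaussianInt} (ha : a.norm = p)
    (h : z.norm = p * m) : a ∣ (z.norm : GaussianInt) := by
  rw [h]
  refine ⟨star a * m, ?_⟩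
  rw [← mul_assoc, ← Zsqrtd.norm_eq_mul_conj, ha]
  push_cast
  rfl

/-- The ramified prime: z of even norm has re and im of equal parity, so it is divisible by 1 + i.
-/
theorem normCount_two_mul (m : ℕ) : normCount (2 * m) = normCount m := by
  have h0 : (⟨1, 1⟩ : GaussianInt) ≠ 0 := by simp [Zsqrtd.ext_iff]
  rw [← ncard_dvd_norm_eq h0 m, normCount]
  congr 1
  ext z
  have hn : (⟨1, 1⟩ : GaussianInt).norm = 2 := rfl
  simp only [mem_ofPred_eq, hn]
  refine ⟨fun h => ⟨?_, h⟩, fun h => h.2⟩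
  rw [gaussianInt_norm_eq] at h
  have h2 : Even (z.re + z.im) := by
    have : Even (z.re ^ 2 + z.im ^ 2) := ⟨m, by linarith⟩
    rw [Int.even_add, Int.even_pow' two_ne_zero, Int.even_pow' two_ne_zero] at this
    exact Int.even_add.2 this
  obtain ⟨k, hk⟩ := h2
  -- With z.re + z.im = 2k, this is the quotient of z by 1 + i.
  refine ⟨⟨k, z.im - k⟩, ?_⟩
  ext
  · simp; linarith
  · simp

/-- The inert case: p stays prime, so p dividing the norm forces p to divide z, and the norm is then
divisible by p². -/
theorem normCount_mul_of_three {p : ℕ} (hp : p.Prime) (h3 : p % 4 = 3) (m : ℕ) :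
    normCount (p * m) = if p ∣ m then normCount ((m / p : ℕ) : ℤ) else 0 := by
  rw [← ncard_natCast_dvd_norm_eq hp.ne_zero, normCount]
  congr 1
  ext z
  refine ⟨fun h => ⟨?_, h⟩, fun h => h.2⟩
  have := Fact.mk hp
  have hpr := prime_of_nat_prime_of_mod_four_eq_three p h3
  have hd : (p : GaussianInt) ∣ (z.norm : GaussianInt) := by
    rw [show z.norm = p * m from h]
    push_cast
    exact dvd_mul_right _ _
  simpa using dvd_or_star_dvd hpr hd

/-- The split case p = a ā: each z of norm pm is divisible by a or by ā, and by both exactly when p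
divides it. Inclusion–exclusion gives the relation. -/
theorem normCount_mul_of_one {p : ℕ} (hp : p.Prime) (h1 : p % 4 = 1) (m : ℕ) :
    normCount (p * m) + (if p ∣ m then normCount ((m / p : ℕ) : ℤ) else 0) = 2 * normCount m := by
  have := Fact.mk hp
  obtain ⟨x, y, hxy⟩ := Nat.Prime.sq_add_sq (p := p) (by omega)
  have hxy' : (x : ℤ) ^ 2 + (y : ℤ) ^ 2 = p := by exact_mod_cast hxy
  set a : GaussianInt := ⟨x, y⟩ with ha
  have hna : a.norm = p := by rw [gaussianInt_norm_eq]; exact hxy'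
  have hnb : (star a).norm = p := by rw [Zsqrtd.norm_conj, hna]
  have hpa := prime_of_norm_prime hp hna
  have hpb := prime_of_norm_prime hp hnb
  have hab : a * star a = p := by rw [← Zsqrtd.norm_eq_mul_conj, hna]; rfl
  -- If ā divided a it would divide a + ā = 2x; taking norms, p divides x, then y, hence p² divides
  -- x² + y² = p.
  have hndvd : ¬ star a ∣ a := fun hd => by
    have h2 : star a ∣ ((2 * x : ℕ) : GaussianInt) := by
      have : ((2 * x : ℕ) : GaussianInt) = a + star a := by
        ext <;> simp [ha]; ring
      rw [this]
      exact dvd_add hd dvd_rfl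
    obtain ⟨w, hw⟩ := h2
    have h3 := congrArg Zsqrtd.norm hw
    rw [Zsqrtd.norm_mul, hnb, Zsqrtd.norm_natCast] at h3
    have h4 : p ∣ 2 * x := by
      have : (p : ℤ) ∣ ((2 * x : ℕ) : ℤ) * ((2 * x : ℕ) : ℤ) := ⟨_, h3⟩
      have h5 : p ∣ 2 * x * (2 * x) := by exact_mod_cast this
      exact (hp.dvd_mul.1 h5).elim id id
    have h6 : p ∣ x := by
      rcases hp.dvd_mul.1 h4 with h | h
      · have := (Nat.prime_dvd_prime_iff_eq hp Nat.prime_two).1 h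
        omega
      · exact h
    have h7 : p ∣ y := by
      have : p ∣ x ^ 2 + y ^ 2 := hxy ▸ dvd_rfl
      exact hp.dvd_of_dvd_pow ((Nat.dvd_add_right (dvd_pow h6 two_ne_zero)).1 this)
    obtain ⟨k, rfl⟩ := h6
    obtain ⟨l, rfl⟩ := h7
    have h8 : p * (p * (k ^ 2 + l ^ 2)) = p * 1 := by rw [mul_one]; nth_rewrite 3 [← hxy]; ring
    have h9 := Nat.eq_of_mul_eq_mul_left hp.pos h8
    exact hp.ne_one (Nat.dvd_one.1 ⟨_, h9.symm⟩)
  have fin : ∀ b : GaussianInt, {z : GaussianInt | b ∣ z ∧ z.norm = p * m}.Finite := fun b =>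
    (finite_norm_eq (p * m)).subset fun z hz => hz.2
  have hU : {z : GaussianInt | z.norm = p * m} = {z | a ∣ z ∧ z.norm = p * m}
      ∪ {z | star a ∣ z ∧ z.norm = p * m} := by
    ext z
    refine ⟨fun h => ?_, fun h => h.elim (fun h => h.2) fun h => h.2⟩
    exact (dvd_or_star_dvd hpa (natCast_dvd_of_norm_eq hna h)).imp (fun h' => ⟨h', h⟩)
      fun h' => ⟨h', h⟩
  have hI : {z : GaussianInt | a ∣ z ∧ z.norm = p * m} ∩ {z | star a ∣ z ∧ z.norm = p * m}
      = {z | (p : GaussianInt) ∣ z ∧ z.norm = p * m} := by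
    ext z
    constructor
    · rintro ⟨⟨⟨w, rfl⟩, h⟩, hd, -⟩
      refine ⟨?_, h⟩
      rw [← hab]
      exact mul_dvd_mul_left a ((hpb.dvd_or_dvd hd).resolve_left hndvd)
    · rintro ⟨hd, h⟩
      rw [← hab] at hd
      exact ⟨⟨(dvd_mul_right _ _).trans hd, h⟩, (dvd_mul_left _ _).trans hd, h⟩
  have key := Set.ncard_union_add_ncard_inter {z : GaussianInt | a ∣ z ∧ z.norm = p * m}
    {z | star a ∣ z ∧ z.norm = p * m} (fin _) (fin _)
  have ca := ncard_dvd_norm_eq hpa.ne_zero m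
  have cb := ncard_dvd_norm_eq hpb.ne_zero m
  rw [hna] at ca
  rw [hnb] at cb
  rw [← hU, hI, ca, cb, ncard_natCast_dvd_norm_eq hp.ne_zero] at key
  rw [two_mul]
  exact key

theorem chi_of_prime {p : ℕ} (hp : p.Prime) :
    p = 2 ∨ (p % 4 = 1 ∧ χ₄ p = 1) ∨ (p % 4 = 3 ∧ χ₄ p = -1) := by
  rcases hp.eq_two_or_odd with h | h
  · exact Or.inl h
  · have : p % 4 = 1 ∨ p % 4 = 3 := by omega
    exact Or.inr (this.imp (fun h => ⟨h, χ₄_nat_one_mod_four h⟩)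
      fun h => ⟨h, χ₄_nat_three_mod_four h⟩)

/-- Hecke relations for the number of representations as a sum of two squares. -/
theorem normCount_hecke {p : ℕ} (hp : p.Prime) (m : ℕ) :
    (normCount ((p * m : ℕ) : ℤ) : ℤ) = (1 + χ₄ p) * normCount m
      - χ₄ p * if p ∣ m then (normCount ((m / p : ℕ) : ℤ) : ℤ) else 0 := by
  push_cast
  rcases chi_of_prime hp with rfl | ⟨h, hχ⟩ | ⟨h, hχ⟩
  · have : χ₄ ((2 : ℕ) : ZMod 4) = 0 := by decide
    rw [this]
    simpa using normCount_two_mul m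
  · rw [hχ]
    have := normCount_mul_of_one hp h m
    have := congrArg (Nat.cast : ℕ → ℤ) this
    push_cast at this
    linarith
  · rw [hχ, normCount_mul_of_three hp h m]
    push_cast
    ring

/-- The divisor sum of the nontrivial character modulo four. -/
def chiSum (n : ℕ) : ℤ := ∑ d ∈ n.divisors, χ₄ d

/-- The divisors of pm are those of m together with p times those of m; the overlap is p times the
divisors of m/p. Complete multiplicativity of the character does the rest. -/
theorem chiSum_hecke {p : ℕ} (hp : p.Prime) {m : ℕ} (hm : m ≠ 0) :
    chiSum (p * m) = (1 + χ₄ p) * chiSum m - χ₄ p * if p ∣ m then chiSum (m / p) else 0 := by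
  have inj : ∀ s : Finset ℕ, Set.InjOn (fun d => p * d) s := fun s =>
    (mul_right_injective₀ hp.ne_zero).injOn
  have sum_image : ∀ n : ℕ, ∑ d ∈ n.divisors.image (fun d => p * d), χ₄ d = χ₄ p * chiSum n := by
    intro n
    rw [Finset.sum_image (inj _), chiSum, Finset.mul_sum]
    exact Finset.sum_congr rfl fun d _ => by push_cast; rw [map_mul]
  have hU : (p * m).divisors = m.divisors ∪ m.divisors.image (fun d => p * d) := by
    ext d
    simp only [Finset.mem_union, Finset.mem_image, Nat.mem_divisors]
    constructor
    · rintro ⟨hd, -⟩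
      by_cases hpd : p ∣ d
      · obtain ⟨e, rfl⟩ := hpd
        exact Or.inr ⟨e, ⟨Nat.dvd_of_mul_dvd_mul_left hp.pos hd, hm⟩, rfl⟩
      · exact Or.inl ⟨((hp.coprime_iff_not_dvd.2 hpd).symm).dvd_of_dvd_mul_left hd, hm⟩
    · rintro (⟨h, -⟩ | ⟨e, ⟨h, -⟩, rfl⟩)
      · exact ⟨h.mul_left p, mul_ne_zero hp.ne_zero hm⟩
      · exact ⟨mul_dvd_mul_left p h, mul_ne_zero hp.ne_zero hm⟩
  have hI : ∑ d ∈ m.divisors ∩ m.divisors.image (fun d => p * d), χ₄ d =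
      χ₄ p * if p ∣ m then chiSum (m / p) else 0 := by
    split_ifs with h
    · obtain ⟨k, rfl⟩ := h
      rw [Nat.mul_div_cancel_left k hp.pos, ← sum_image]
      congr 1
      ext d
      simp only [Finset.mem_inter, Finset.mem_image, Nat.mem_divisors]
      constructor
      · rintro ⟨⟨h, -⟩, e, -, rfl⟩
        exact ⟨e, ⟨Nat.dvd_of_mul_dvd_mul_left hp.pos h, right_ne_zero_of_mul hm⟩, rfl⟩
      · rintro ⟨e, ⟨h, -⟩, rfl⟩
        exact ⟨⟨mul_dvd_mul_left p h, hm⟩, e, ⟨h.mul_left p, hm⟩, rfl⟩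
    · rw [mul_zero, Finset.sum_eq_zero]
      intro d hd
      simp only [Finset.mem_inter, Finset.mem_image, Nat.mem_divisors] at hd
      obtain ⟨⟨h1, -⟩, e, -, rfl⟩ := hd
      exact absurd ((dvd_mul_right p e).trans h1) h
  have key := Finset.sum_union_inter (s₁ := m.divisors)
    (s₂ := m.divisors.image (fun d => p * d)) (f := fun d : ℕ => χ₄ d)
  rw [← hU, hI, sum_image] at key
  change chiSum (p * m) + _ = chiSum m + _ at key
  linarith

theorem normCount_one : normCount 1 = 4 := by
  have : {z : GaussianInt | z.norm = 1} =
      (({⟨1, 0⟩, ⟨-1, 0⟩, ⟨0, 1⟩, ⟨0, -1⟩} : Finset GaussianInt) : Set GaussianInt) := by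
    ext z
    obtain ⟨a, b⟩ := z
    simp only [mem_ofPred_eq, gaussianInt_norm_eq, Finset.coe_insert, Finset.coe_singleton,
      mem_insert_iff, mem_singleton_iff, Zsqrtd.mk.injEq]
    constructor
    · intro h
      have ha : a ^ 2 ≤ 1 := by nlinarith [sq_nonneg b]
      have hb : b ^ 2 ≤ 1 := by nlinarith [sq_nonneg a]
      have ha1 : -1 ≤ a := by nlinarith
      have ha2 : a ≤ 1 := by nlinarith
      have hb1 : -1 ≤ b := by nlinarith
      have hb2 : b ≤ 1 := by nlinarith
      interval_cases a <;> interval_cases b <;> simp_all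
    · rintro (⟨rfl, rfl⟩ | ⟨rfl, rfl⟩ | ⟨rfl, rfl⟩ | ⟨rfl, rfl⟩) <;> norm_num
  rw [normCount, this, Set.ncard_coe_finset]
  rfl

/-- **Jacobi's two-square theorem**. -/
theorem normCount_eq {n : ℕ} (hn : n ≠ 0) : (normCount n : ℤ) = 4 * chiSum n := by
  induction n using Nat.strong_induction_on with
  | _ n ih =>
    by_cases h1 : n = 1
    · subst h1
      rw [Nat.cast_one, normCount_one, chiSum]
      simp
    · have hp := Nat.minFac_prime h1
      obtain ⟨m, hm⟩ := Nat.minFac_dvd n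
      set p := n.minFac
      have hm0 : m ≠ 0 := by rintro rfl; exact hn (by rw [hm, mul_zero])
      have hlt : m < n := by
        rw [hm]; exact lt_mul_left (Nat.pos_of_ne_zero hm0) hp.one_lt
      rw [hm, normCount_hecke hp, chiSum_hecke hp hm0, ih m hlt hm0]
      split_ifs with h
      · have hmp : m / p ≠ 0 := (Nat.div_pos (Nat.le_of_dvd (Nat.pos_of_ne_zero hm0) h) hp.pos).ne'
        rw [ih (m / p) ((Nat.div_le_self m p).trans_lt hlt) hmp]
        ring
      · ring

end MKSE

/-! ### Catalan's constant and the lattice sum of |k|⁻⁴. -/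

namespace MKSE

open ZMod GaussianInt

theorem abs_chi_le_one (n : ℕ) : |((χ₄ n : ℤ) : ℝ)| ≤ 1 := by
  rw [χ₄_nat_eq_if_mod_four]
  split_ifs <;> simp

theorem summable_chi_div_sq : Summable fun n : ℕ => (χ₄ n : ℝ) / (n : ℝ) ^ 2 := by
  refine Summable.of_norm_bounded (Real.summable_one_div_nat_pow.2 one_lt_two) fun n => ?_
  rw [norm_div, Real.norm_eq_abs, Real.norm_of_nonneg (by positivity : (0 : ℝ) ≤ (n : ℝ) ^ 2)]
  gcongr
  exact abs_chi_le_one n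

theorem hasSum_chi_div_sq : HasSum (fun n : ℕ => (χ₄ n : ℝ) / (n : ℝ) ^ 2) catalanConst := by
  have he : ∀ k : ℕ, (χ₄ (2 * k : ℕ) : ℝ) / ((2 * k : ℕ) : ℝ) ^ 2 = 0 := fun k => by
    rw [χ₄_nat_eq_if_mod_four]; simp
  have ho : ∀ k : ℕ, (χ₄ (2 * k + 1 : ℕ) : ℝ) / ((2 * k + 1 : ℕ) : ℝ) ^ 2
      = (-1 : ℝ) ^ k / (2 * (k : ℝ) + 1) ^ 2 := fun k => by
    rw [χ₄_eq_neg_one_pow (by omega), show (2 * k + 1) / 2 = k by omega]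
    push_cast
    rfl
  have hs := summable_chi_div_sq.comp_injective
    (i := fun k : ℕ => 2 * k + 1) (fun a b h => by simpa using h)
  have h := HasSum.even_add_odd (f := fun n : ℕ => (χ₄ n : ℝ) / (n : ℝ) ^ 2) (m := 0)
    (m' := catalanConst) (by simp only [he]; exact hasSum_zero) (by
      have := hs.hasSum
      simp only [Function.comp_def, ho] at this
      simp only [ho]
      exact this)
  rwa [zero_add] at h

/-- Dirichlet convolution at s = 2: multiply the two absolutely convergent series and group the
pairs by their product. -/
theorem hasSum_divisors_sum_div_sq {f : ℕ → ℝ} {A B : ℝ}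
    (hf : HasSum (fun n : ℕ => f n / (n : ℝ) ^ 2) A)
    (hg : HasSum (fun n : ℕ => 1 / (n : ℝ) ^ 2) B) :
    HasSum (fun n : ℕ => (∑ d ∈ n.divisors, f d) / (n : ℝ) ^ 2) (A * B) := by
  have hsum := summable_mul_of_summable_norm (f := fun n : ℕ => f n / (n : ℝ) ^ 2)
    (g := fun n : ℕ => 1 / (n : ℝ) ^ 2) hf.summable.norm hg.summable.norm
  have hprod := hf.mul hg hsum
  have h3 := hprod.tsum_fiberwise (fun p : ℕ × ℕ => p.1 * p.2)
  convert! h3 using 1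
  ext n
  -- The fibre over 0 is infinite, but its terms vanish because division by zero gives 0.
  rcases eq_or_ne n 0 with rfl | hn
  · have : ∀ b : (fun p : ℕ × ℕ => p.1 * p.2) ⁻¹' {0},
        f b.1.1 / (b.1.1 : ℝ) ^ 2 * (1 / (b.1.2 : ℝ) ^ 2) = 0 := by
      rintro ⟨⟨a, b⟩, hab⟩
      rcases mul_eq_zero.1 (show a * b = 0 from hab) with rfl | rfl <;> simp
    rw [tsum_congr this]
    simp
  · rw [show (fun p : ℕ × ℕ => p.1 * p.2) ⁻¹' {n} = (n.divisorsAntidiagonal : Set (ℕ × ℕ)) by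
        ext; simp [hn],
      Finset.tsum_subtype' n.divisorsAntidiagonal
        fun p : ℕ × ℕ => f p.1 / (p.1 : ℝ) ^ 2 * (1 / (p.2 : ℝ) ^ 2), Finset.sum_div,
      ← Nat.sum_divisorsAntidiagonal (f := fun d _ => f d / (n : ℝ) ^ 2)]
    refine Finset.sum_congr rfl fun p hp => ?_
    rw [← (Nat.mem_divisorsAntidiagonal.1 hp).1]
    push_cast
    rw [div_mul_div_comm, mul_one, mul_pow]

theorem hasSum_chiSum_div_sq :
    HasSum (fun n : ℕ => (chiSum n : ℝ) / (n : ℝ) ^ 2) (catalanConst * (Real.pi ^ 2 / 6)) := by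
  have := hasSum_divisors_sum_div_sq (f := fun n => ((χ₄ n : ℤ) : ℝ)) hasSum_chi_div_sq
    hasSum_zeta_two
  simpa only [chiSum, Int.cast_sum] using this

/-- The divisor sums are nonnegative since they are quarters of cardinalities, so the product with
ζ(2) is nonnegative. -/
theorem catalanConst_nonneg : 0 ≤ catalanConst := by
  have h : 0 ≤ catalanConst * (Real.pi ^ 2 / 6) := by
    refine hasSum_chiSum_div_sq.nonneg fun n => div_nonneg ?_ (by positivity)
    rcases eq_or_ne n 0 with rfl | hn
    · simp [chiSum]
    · have := normCount_eq hn
      have h0 : 0 ≤ chiSum n := by omega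
      exact_mod_cast h0
  exact nonneg_of_mul_nonneg_left h (by positivity)

/-- The lattice sum `∑ |k|⁻⁴` over the Gaussian integers, in extended nonnegative reals. -/
theorem tsum_norm_inv_sq :
    ∑' z : GaussianInt, ENNReal.ofReal (1 / (z.norm : ℝ) ^ 2) =
      ENNReal.ofReal (4 * (catalanConst * (Real.pi ^ 2 / 6))) := by
  have hs := hasSum_chiSum_div_sq.mul_left 4
  have hterm : ∀ n : ℕ, (normCount n : ℝ) * (1 / (n : ℝ) ^ 2) =
      4 * ((chiSum n : ℝ) / (n : ℝ) ^ 2) := fun n => by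
    rcases eq_or_ne n 0 with rfl | hn
    · simp
    · have : (normCount n : ℝ) = 4 * chiSum n := by exact_mod_cast normCount_eq hn
      rw [this]; ring
  simp only [← hterm] at hs
  -- Regroup the Gaussian integers by norm; z = 0 contributes 1/0 = 0 and needs no exclusion.
  rw [← hs.tsum_eq, ENNReal.ofReal_tsum_of_nonneg (fun n => by positivity) hs.summable,
    ← (Equiv.sigmaFiberEquiv fun z : GaussianInt => z.norm.natAbs).tsum_eq, ENNReal.tsum_sigma']
  refine tsum_congr fun n => ?_
  have hfib : ∀ c : { z : GaussianInt // z.norm.natAbs = n },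
      ENNReal.ofReal (1 / ((Equiv.sigmaFiberEquiv fun z : GaussianInt => z.norm.natAbs)
        ⟨n, c⟩).norm ^ 2) = ENNReal.ofReal (1 / (n : ℝ) ^ 2) := by
    rintro ⟨z, hz⟩
    have : (z.norm : ℝ) = n := by
      rw [← hz, ← abs_natCast_norm]; simp
    simp only [Equiv.sigmaFiberEquiv_apply, this]
  have hset : {z : GaussianInt | z.norm = n} = {z | z.norm.natAbs = n} := by
    ext z
    have := norm_nonneg z
    simp only [mem_ofPred_eq]
    omega
  have hfin := finite_norm_eq n
  rw [tsum_congr hfib, ENNReal.tsum_const, normCount, hset, ENNReal.ofReal_mul (by positivity),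
    ENNReal.ofReal_natCast]
  congr 1
  rw [hset] at hfin
  have hcard : ENat.card { z : GaussianInt // z.norm.natAbs = n } =
      {z : GaussianInt | z.norm.natAbs = n}.encard := rfl
  rw [hcard, ← hfin.cast_ncard_eq, ENat.toENNReal_coe]

end MKSE

/-! ### Fourier series on the torus: sharp Sobolev and Poincaré inequalities. -/

namespace MKSE

open UnitAddTorus

section UnitTorus

/-- The normalized measure on the unit circle. -/
noncomputable local instance : MeasureSpace UnitAddCircle := ⟨AddCircle.haarAddCircle⟩

/-- The measure on the unit circle is a probability measure. -/
local instance : IsProbabilityMeasure (volume : Measure UnitAddCircle) :=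
  inferInstanceAs (IsProbabilityMeasure AddCircle.haarAddCircle)

variable {φ : ℝ × ℝ → ℝ}

/-- Transports periodic functions on the plane to the torus, where the Fourier theory lives.
Continuity is checked upstairs, along the open quotient map from the plane. -/
theorem Per.exists_torus_lift (h : Per 1 φ) :
    ∃ F : C(UnitAddTorus (Fin 2), ℂ), ∀ x : Fin 2 → ℝ,
      F (fun i => (x i : UnitAddCircle)) = (φ (x 0, x 1) : ℂ) := by
  have hy : ∀ x, Function.Periodic (fun y => φ (x, y)) 1 := fun x y => h.py x y
  have hx : Function.Periodic (fun x => (hy x).lift) 1 := fun x => by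
    ext θ
    obtain ⟨y, rfl⟩ := QuotientAddGroup.mk_surjective θ
    exact h.px x y
  have hq : IsOpenQuotientMap (Pi.map fun (_ : Fin 2) (x : ℝ) => (x : UnitAddCircle)) :=
    IsOpenQuotientMap.piMap fun _ => QuotientAddGroup.isOpenQuotientMap_mk
  have hcomp : ∀ x : Fin 2 → ℝ, ((hx.lift (x 0 : UnitAddCircle) (x 1 : UnitAddCircle) : ℝ) : ℂ)
      = (φ (x 0, x 1) : ℂ) := fun x => rfl
  refine ⟨⟨fun θ => ((hx.lift (θ 0) (θ 1) : ℝ) : ℂ), ?_⟩, hcomp⟩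
  rw [hq.isQuotientMap.continuous_iff]
  have : Continuous fun x : Fin 2 → ℝ => (φ (x 0, x 1) : ℂ) :=
    Complex.continuous_ofReal.comp (h.continuous.comp (by fun_prop))
  exact this

theorem setIntegral_unit_cube {E : Type*} [NormedAddCommGroup E] [NormedSpace ℝ E]
    (g : ℝ × ℝ → E) :
    ∫ x in {x : Fin 2 → ℝ | ∀ i, x i ∈ Ioc ((0 : Fin 2 → ℝ) i) ((0 : Fin 2 → ℝ) i + 1)},
      g (x 0, x 1) = ∫ p in square 1, g p := by
  have hmp := volume_preserving_finTwoArrow ℝ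
  have hset : {x : Fin 2 → ℝ | ∀ i, x i ∈ Ioc ((0 : Fin 2 → ℝ) i) ((0 : Fin 2 → ℝ) i + 1)} =
      (MeasurableEquiv.finTwoArrow : (Fin 2 → ℝ) ≃ᵐ ℝ × ℝ) ⁻¹' (Ioc 0 1 ×ˢ Ioc 0 1) := by
    ext x
    simp [Fin.forall_fin_two, MeasurableEquiv.finTwoArrow]
  have h2 := hmp.setIntegral_preimage_emb (MeasurableEquiv.measurableEmbedding _) g
    (Ioc 0 1 ×ˢ Ioc 0 1)
  rw [hset]
  refine h2.trans (setIntegral_congr_set ?_)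
  exact Measure.set_prod_ae_eq Ioc_ae_eq_Icc Ioc_ae_eq_Icc

/-- The plane wave with wave vector `k`, real part. -/
noncomputable def cosWave (k : Fin 2 → ℤ) (p : ℝ × ℝ) : ℝ :=
  Real.cos (2 * Real.pi * (k 0 * p.1 + k 1 * p.2))

/-- The plane wave with wave vector `k`, imaginary part. -/
noncomputable def sinWave (k : Fin 2 → ℤ) (p : ℝ × ℝ) : ℝ :=
  Real.sin (2 * Real.pi * (k 0 * p.1 + k 1 * p.2))

theorem per_cosWave (k : Fin 2 → ℤ) : Per 1 (cosWave k) := by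
  refine ⟨by unfold cosWave; fun_prop, fun x y => ?_, fun x y => ?_⟩
  · simp only [cosWave]
    rw [← Real.cos_add_int_mul_two_pi (2 * Real.pi * (k 0 * x + k 1 * y)) (k 0)]
    congr 1
    ring
  · simp only [cosWave]
    rw [← Real.cos_add_int_mul_two_pi (2 * Real.pi * (k 0 * x + k 1 * y)) (k 1)]
    congr 1
    ring

theorem per_sinWave (k : Fin 2 → ℤ) : Per 1 (sinWave k) := by
  refine ⟨by unfold sinWave; fun_prop, fun x y => ?_, fun x y => ?_⟩
  · simp only [sinWave]
    rw [← Real.sin_add_int_mul_two_pi (2 * Real.pi * (k 0 * x + k 1 * y)) (k 0)]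
    congr 1
    ring
  · simp only [sinWave]
    rw [← Real.sin_add_int_mul_two_pi (2 * Real.pi * (k 0 * x + k 1 * y)) (k 1)]
    congr 1
    ring

theorem hasDerivAt_phase_x (k : Fin 2 → ℤ) (p : ℝ × ℝ) :
    HasDerivAt (fun s : ℝ => 2 * Real.pi * (k 0 * s + k 1 * p.2)) (2 * Real.pi * k 0) p.1 := by
  simpa using (((hasDerivAt_id p.1).const_mul (k 0 : ℝ)).add_const (k 1 * p.2)).const_mul
    (2 * Real.pi)

theorem hasDerivAt_phase_y (k : Fin 2 → ℤ) (p : ℝ × ℝ) :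
    HasDerivAt (fun s : ℝ => 2 * Real.pi * (k 0 * p.1 + k 1 * s)) (2 * Real.pi * k 1) p.2 := by
  simpa using (((hasDerivAt_id p.2).const_mul (k 1 : ℝ)).const_add (k 0 * p.1)).const_mul
    (2 * Real.pi)

theorem dx_const_mul (c : ℝ) (f : ℝ × ℝ → ℝ) : dx (fun p => c * f p) = fun p => c * dx f p := by
  ext p; exact deriv_const_mul_field c

theorem dy_const_mul (c : ℝ) (f : ℝ × ℝ → ℝ) : dy (fun p => c * f p) = fun p => c * dy f p := by
  ext p; exact deriv_const_mul_field c

theorem dx_cosWave (k : Fin 2 → ℤ) :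
    dx (cosWave k) = fun p => -(2 * Real.pi * k 0) * sinWave k p := by
  ext p
  refine (hasDerivAt_phase_x k p).cos.deriv.trans ?_
  rw [sinWave]; ring

theorem dy_cosWave (k : Fin 2 → ℤ) :
    dy (cosWave k) = fun p => -(2 * Real.pi * k 1) * sinWave k p := by
  ext p
  refine (hasDerivAt_phase_y k p).cos.deriv.trans ?_
  rw [sinWave]; ring

theorem dx_sinWave (k : Fin 2 → ℤ) :
    dx (sinWave k) = fun p => (2 * Real.pi * k 0) * cosWave k p := by
  ext p
  refine (hasDerivAt_phase_x k p).sin.deriv.trans ?_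
  rw [cosWave]; ring

theorem dy_sinWave (k : Fin 2 → ℤ) :
    dy (sinWave k) = fun p => (2 * Real.pi * k 1) * cosWave k p := by
  ext p
  refine (hasDerivAt_phase_y k p).sin.deriv.trans ?_
  rw [cosWave]; ring

/-- The eigenvalue of minus the Laplacian for the wave vector `k`. -/
noncomputable def waveEigenvalue (k : Fin 2 → ℤ) : ℝ :=
  4 * Real.pi ^ 2 * ((k 0 : ℝ) ^ 2 + (k 1 : ℝ) ^ 2)

theorem lap_cosWave (k : Fin 2 → ℤ) (p : ℝ × ℝ) :
    lap (cosWave k) p = -waveEigenvalue k * cosWave k p := by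
  rw [lap, dx_cosWave, dy_cosWave, dx_const_mul, dy_const_mul, dx_sinWave, dy_sinWave,
    waveEigenvalue]
  ring

theorem lap_sinWave (k : Fin 2 → ℤ) (p : ℝ × ℝ) :
    lap (sinWave k) p = -waveEigenvalue k * sinWave k p := by
  rw [lap, dx_sinWave, dy_sinWave, dx_const_mul, dy_const_mul, dx_cosWave, dy_cosWave,
    waveEigenvalue]
  ring

/-- The Fourier coefficients of a function on the unit square. -/
noncomputable def waveCoeff (φ : ℝ × ℝ → ℝ) (k : Fin 2 → ℤ) : ℂ :=
  (avg 1 (fun p => φ p * cosWave k p) : ℂ) - (avg 1 (fun p => φ p * sinWave k p) : ℂ) * Complex.I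

theorem mFourier_coe (k : Fin 2 → ℤ) (x : Fin 2 → ℝ) :
    mFourier k (fun i => (x i : UnitAddCircle)) =
      (cosWave k (x 0, x 1) : ℂ) + (sinWave k (x 0, x 1) : ℂ) * Complex.I := by
  simp only [mFourier, ContinuousMap.coe_mk, Fin.prod_univ_two, fourier_coe_apply]
  rw [← Complex.exp_add, cosWave, sinWave, Complex.ofReal_cos, Complex.ofReal_sin,
    ← Complex.exp_mul_I]
  congr 1
  push_cast
  ring

theorem mFourierCoeff_eq_waveCoeff (h : Per 1 φ) {F : C(UnitAddTorus (Fin 2), ℂ)}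
    (hF : ∀ x : Fin 2 → ℝ, F (fun i => (x i : UnitAddCircle)) = (φ (x 0, x 1) : ℂ))
    (k : Fin 2 → ℤ) : mFourierCoeff F k = waveCoeff φ k := by
  rw [mFourierCoeff_eq_integral F k 0]
  have e : ∀ x : Fin 2 → ℝ, mFourier (-k) (fun i => (x i : UnitAddCircle)) •
      F (fun i => (x i : UnitAddCircle)) =
      (fun p : ℝ × ℝ => ((φ p * cosWave k p : ℝ) : ℂ) - ((φ p * sinWave k p : ℝ) : ℂ) * Complex.I)
        (x 0, x 1) := fun x => by
    rw [hF, mFourier_neg, mFourier_coe]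
    simp only [map_add, map_mul, Complex.conj_ofReal, Complex.conj_I, smul_eq_mul]
    push_cast
    ring
  simp only [e]
  rw [setIntegral_unit_cube (fun p : ℝ × ℝ => ((φ p * cosWave k p : ℝ) : ℂ)
    - ((φ p * sinWave k p : ℝ) : ℂ) * Complex.I), integral_sub, integral_mul_const,
    integral_complex_ofReal, integral_complex_ofReal]
  · rfl
  · exact (h.mul (per_cosWave k)).continuous.integrableOn_square.ofReal
  · exact (h.mul (per_sinWave k)).continuous.integrableOn_square.ofReal.mul_const _

/-- Green's second identity moves the Laplacian onto the wave, an eigenfunction. -/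
theorem waveCoeff_lap (h : Per 1 φ) (k : Fin 2 → ℤ) :
    waveCoeff (lap φ) k = -(waveEigenvalue k : ℂ) * waveCoeff φ k := by
  have hc : avg 1 (fun p => lap φ p * cosWave k p) =
      -waveEigenvalue k * avg 1 (fun p => φ p * cosWave k p) := by
    rw [← avg_mul_lap_comm h (per_cosWave k) zero_le_one, ← avg_const_mul]
    exact avg_congr fun p => by rw [lap_cosWave]; ring
  have hs : avg 1 (fun p => lap φ p * sinWave k p) =
      -waveEigenvalue k * avg 1 (fun p => φ p * sinWave k p) := by
    rw [← avg_mul_lap_comm h (per_sinWave k) zero_le_one, ← avg_const_mul]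
    exact avg_congr fun p => by rw [lap_sinWave]; ring
  rw [waveCoeff, waveCoeff, hc, hs]
  push_cast
  ring

theorem waveCoeff_zero : waveCoeff φ 0 = (avg 1 φ : ℂ) := by
  have hc : avg 1 (fun p => φ p * cosWave 0 p) = avg 1 φ :=
    avg_congr fun p => by simp [cosWave]
  have hs : avg 1 (fun p => φ p * sinWave 0 p) = 0 := by
    rw [avg_congr (ψ := fun _ => 0) fun p => by simp [sinWave], avg_const zero_le_one, mul_zero]
  rw [waveCoeff, hc, hs]
  simp

/-- Parseval's identity. -/
theorem hasSum_sq_waveCoeff (h : Per 1 φ) :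
    HasSum (fun k => ‖waveCoeff φ k‖ ^ 2) (avg 1 (fun p => φ p ^ 2)) := by
  obtain ⟨F, hF⟩ := h.exists_torus_lift
  have key := hasSum_sq_mFourierCoeff (ContinuousMap.toLp 2 volume ℂ F)
  simp only [mFourierCoeff_toLp, mFourierCoeff_eq_waveCoeff h hF] at key
  convert! key using 1
  rw [integral_congr_ae ((F.coeFn_toLp (p := 2) (𝕜 := ℂ) volume).mono fun t ht => by
    simp only [ht] : (fun t => ‖(ContinuousMap.toLp 2 volume ℂ F) t‖ ^ 2) =ᵐ[volume] fun t => ‖F t‖ ^ 2),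
    integral_preimage (fun t => ‖F t‖ ^ 2) 0]
  simp only [hF, Complex.norm_real, Real.norm_eq_abs, sq_abs]
  exact (setIntegral_unit_cube fun p => φ p ^ 2).symm

theorem hasSum_waveCoeff (h : Per 1 φ) (hs : Summable (waveCoeff φ)) (p : ℝ × ℝ) :
    HasSum (fun k => waveCoeff φ k *
      ((cosWave k p : ℂ) + (sinWave k p : ℂ) * Complex.I)) (φ p : ℂ) := by
  obtain ⟨F, hF⟩ := h.exists_torus_lift
  have hco : mFourierCoeff F = waveCoeff φ := funext fun k => mFourierCoeff_eq_waveCoeff h hF k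
  have key := hasSum_mFourier_series_apply_of_summable (f := F) (by rw [hco]; exact hs)
    (fun i => ((![p.1, p.2] : Fin 2 → ℝ) i : UnitAddCircle))
  simpa only [hco, hF, mFourier_coe, smul_eq_mul, Matrix.cons_val_zero, Matrix.cons_val_one,
    Prod.mk.eta] using key

theorem norm_wave (k : Fin 2 → ℤ) (p : ℝ × ℝ) :
    ‖(cosWave k p : ℂ) + (sinWave k p : ℂ) * Complex.I‖ = 1 := by
  rw [cosWave, sinWave, Complex.ofReal_cos, Complex.ofReal_sin, ← Complex.exp_mul_I,
    Complex.norm_exp_ofReal_mul_I]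

/-- Wave vectors are identified with Gaussian integers, so the value is 4 ζ(2) K / (16 π⁴). The zero
mode again contributes 0. -/
theorem hasSum_inv_waveEigenvalue_sq :
    HasSum (fun k => (1 / waveEigenvalue k) ^ 2) (catalanConst / (24 * Real.pi ^ 2)) := by
  let e : (Fin 2 → ℤ) ≃ GaussianInt :=
    { toFun := fun k => ⟨k 0, k 1⟩
      invFun := fun z => ![z.re, z.im]
      left_inv := fun k => by ext i; fin_cases i <;> rfl
      right_inv := fun z => rfl }
  have hw : ∀ k, (1 / waveEigenvalue k) ^ 2 = 1 / (16 * Real.pi ^ 4) * (1 / ((e k).norm : ℝ) ^ 2) :=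
    fun k => by
      rw [gaussianInt_norm_eq, waveEigenvalue]
      change _ = 1 / (16 * Real.pi ^ 4) * (1 / (((k 0 ^ 2 + k 1 ^ 2 : ℤ) : ℝ)) ^ 2)
      push_cast
      rw [div_pow, one_pow, mul_pow, one_div_mul_one_div]
      ring_nf
  have hval : catalanConst / (24 * Real.pi ^ 2) =
      1 / (16 * Real.pi ^ 4) * (4 * (catalanConst * (Real.pi ^ 2 / 6))) := by
    have := Real.pi_ne_zero
    field_simp
    ring
  simp only [hw, hval]
  refine HasSum.mul_left _ ((Equiv.hasSum_iff e (f := fun z : GaussianInt =>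
    1 / (z.norm : ℝ) ^ 2)).2 ?_)
  have hnn : 0 ≤ 4 * (catalanConst * (Real.pi ^ 2 / 6)) :=
    mul_nonneg (by norm_num) (mul_nonneg catalanConst_nonneg (by positivity))
  have hsum : Summable fun z : GaussianInt => 1 / (z.norm : ℝ) ^ 2 := by
    have h1 := ENNReal.summable_toReal (f := fun z : GaussianInt =>
      ENNReal.ofReal (1 / (z.norm : ℝ) ^ 2)) (by rw [tsum_norm_inv_sq]; exact ENNReal.ofReal_ne_top)
    refine h1.congr fun z => ENNReal.toReal_ofReal (by positivity)
  have h2 := tsum_norm_inv_sq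
  rw [← ENNReal.ofReal_tsum_of_nonneg (fun z => by positivity) hsum] at h2
  rw [← (ENNReal.ofReal_eq_ofReal_iff (tsum_nonneg fun z => by positivity) hnn).1 h2]
  exact hsum.hasSum

theorem waveEigenvalue_lower {k : Fin 2 → ℤ} (hk : k ≠ 0) : 4 * Real.pi ^ 2 ≤ waveEigenvalue k := by
  have h1 : (1 : ℤ) ≤ k 0 ^ 2 + k 1 ^ 2 := by
    by_contra! hlt
    have h0 : k 0 ^ 2 + k 1 ^ 2 = 0 := le_antisymm (by omega) (by positivity)
    have h2 : k 0 = 0 := by nlinarith [sq_nonneg (k 0), sq_nonneg (k 1)]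
    have h3 : k 1 = 0 := by nlinarith [sq_nonneg (k 0), sq_nonneg (k 1)]
    exact hk (by ext i; fin_cases i <;> assumption)
  have h2 : (1 : ℝ) ≤ (k 0 : ℝ) ^ 2 + (k 1 : ℝ) ^ 2 := by exact_mod_cast h1
  rw [waveEigenvalue]
  nlinarith [sq_nonneg Real.pi]

theorem norm_waveCoeff_eq (h : Per 1 φ) {k : Fin 2 → ℤ} (hk : k ≠ 0) :
    ‖waveCoeff φ k‖ = ‖waveCoeff (lap φ) k‖ * (1 / waveEigenvalue k) := by
  have h1 : 0 < waveEigenvalue k := lt_of_lt_of_le (by positivity) (waveEigenvalue_lower hk)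
  rw [waveCoeff_lap h, norm_mul, norm_neg, Complex.norm_real, Real.norm_of_nonneg h1.le]
  field_simp

/-- The sharp Sobolev embedding on the unit torus. -/
theorem sub_mean_sq_le_unit (h : Per 1 φ) (p : ℝ × ℝ) :
    (φ p - avg 1 φ) ^ 2 ≤
      catalanConst / (24 * Real.pi ^ 2) * avg 1 (fun p => lap φ p ^ 2) := by
  have hb := hasSum_sq_waveCoeff h.lap
  have hw := hasSum_inv_waveEigenvalue_sq
  have hwn : ∀ k, 0 ≤ 1 / waveEigenvalue k := fun k => by unfold waveEigenvalue; positivity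
  -- Cauchy–Schwarz gives at once the summability of the Fourier series and the constant.
  have cs := Real.summable_and_inner_le_Lp_mul_Lq_tsum_of_nonneg Real.HolderConjugate.two_two
    (f := fun k => ‖waveCoeff (lap φ) k‖) (g := fun k => 1 / waveEigenvalue k)
    (fun k => norm_nonneg _) hwn (by simpa using hb.summable)
    (by simpa only [Real.rpow_two] using hw.summable)
  simp only [Real.rpow_two, hb.tsum_eq, hw.tsum_eq] at cs
  obtain ⟨cs1, cs2⟩ := cs
  have hs : Summable (waveCoeff φ) := by
    refine Summable.of_norm_bounded_eventually cs1 ?_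
    filter_upwards [(Set.finite_singleton (0 : Fin 2 → ℤ)).compl_mem_cofinite] with k hk
    exact (norm_waveCoeff_eq h (by simpa using hk)).le
  -- Removing the mode k = 0 subtracts exactly the mean.
  have hsub := hasSum_ite_sub_hasSum (hasSum_waveCoeff h hs p) 0
  have hb0 : ∀ k : Fin 2 → ℤ, ‖(if k = 0 then 0 else waveCoeff φ k *
      ((cosWave k p : ℂ) + (sinWave k p : ℂ) * Complex.I))‖ ≤
      ‖waveCoeff (lap φ) k‖ * (1 / waveEigenvalue k) := fun k => by
    split_ifs with hk
    · rw [norm_zero]; exact mul_nonneg (norm_nonneg _) (hwn k)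
    · rw [norm_mul, norm_wave, mul_one, norm_waveCoeff_eq h hk]
  have h1 := tsum_of_norm_bounded cs1.hasSum hb0
  rw [hsub.tsum_eq, waveCoeff_zero] at h1
  have e0 : ((cosWave 0 p : ℂ) + (sinWave 0 p : ℂ) * Complex.I) = 1 := by simp [cosWave, sinWave]
  rw [e0, mul_one, ← Complex.ofReal_sub, Complex.norm_real, Real.norm_eq_abs] at h1
  have h2 := pow_le_pow_left₀ (abs_nonneg _) (h1.trans cs2) 2
  rw [sq_abs, mul_pow, ← Real.sqrt_eq_rpow, ← Real.sqrt_eq_rpow,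
    Real.sq_sqrt (avg_nonneg fun p => sq_nonneg _), Real.sq_sqrt (by
      have := catalanConst_nonneg; positivity)] at h2
  linarith

/-- Poincaré's inequality on the unit torus. -/
theorem poincare_unit (h : Per 1 φ) (h0 : avg 1 φ = 0) :
    (4 * Real.pi ^ 2) ^ 2 * avg 1 (fun p => φ p ^ 2) ≤ avg 1 (fun p => lap φ p ^ 2) := by
  refine hasSum_le (fun k => ?_) ((hasSum_sq_waveCoeff h).mul_left _) (hasSum_sq_waveCoeff h.lap)
  by_cases hk : k = 0
  · subst hk
    rw [waveCoeff_zero, h0]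
    simp
  · have h1 : 4 * Real.pi ^ 2 ≤ |waveEigenvalue k| :=
      (waveEigenvalue_lower hk).trans (le_abs_self _)
    rw [waveCoeff_lap h, norm_mul, norm_neg, Complex.norm_real, Real.norm_eq_abs,
      mul_pow |waveEigenvalue k|]
    gcongr

end UnitTorus

/-! ### Scaling from the unit torus to period L. -/

section Scaling

variable {L : ℝ} {φ : ℝ × ℝ → ℝ}

theorem Per.rescale (h : Per L φ) : Per 1 (fun p => φ (L * p.1, L * p.2)) :=
  ⟨h.smooth.comp (by fun_prop), fun x y => by simp only [mul_add, mul_one, h.px],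
    fun x y => by simp only [mul_add, mul_one, h.py]⟩

theorem dx_rescale (φ : ℝ × ℝ → ℝ) (L : ℝ) :
    dx (fun p => φ (L * p.1, L * p.2)) = fun p => L * dx φ (L * p.1, L * p.2) := by
  ext p
  exact deriv_comp_mul_left L (fun s => φ (s, L * p.2)) p.1

theorem dy_rescale (φ : ℝ × ℝ → ℝ) (L : ℝ) :
    dy (fun p => φ (L * p.1, L * p.2)) = fun p => L * dy φ (L * p.1, L * p.2) := by
  ext p
  exact deriv_comp_mul_left L (fun s => φ (L * p.1, s)) p.2

theorem lap_rescale (φ : ℝ × ℝ → ℝ) (L : ℝ) (p : ℝ × ℝ) :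
    lap (fun p => φ (L * p.1, L * p.2)) p = L ^ 2 * lap φ (L * p.1, L * p.2) := by
  rw [lap, dx_rescale, dy_rescale, dx_const_mul, dy_const_mul, dx_rescale, dy_rescale, lap]
  ring

theorem avg_rescale (hL : 0 < L) (h : Continuous φ) :
    avg 1 (fun p => φ (L * p.1, L * p.2)) = avg L φ / L ^ 2 := by
  rw [avg_eq_xy zero_le_one (φ := fun p => φ (L * p.1, L * p.2)) (h.comp (by fun_prop)), avg_eq_xy hL.le h]
  have h1 : ∀ x, ∫ y in (0 : ℝ)..1, φ (L * x, L * y) = L⁻¹ * ∫ y in 0..L, φ (L * x, y) := fun x => by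
    rw [intervalIntegral.integral_comp_mul_left (fun y => φ (L * x, y)) hL.ne', mul_zero, mul_one,
      smul_eq_mul]
  simp only [h1]
  rw [intervalIntegral.integral_const_mul,
    intervalIntegral.integral_comp_mul_left (fun x => ∫ y in 0..L, φ (x, y)) hL.ne', mul_zero,
    mul_one, smul_eq_mul]
  field_simp

/-- The sharp Sobolev embedding for periodic functions. -/
theorem Per.sub_mean_sq_le (h : Per L φ) (hL : 0 < L) (p : ℝ × ℝ) :
    (φ p - avg L φ / L ^ 2) ^ 2 ≤
      (L / (2 * Real.pi)) ^ 2 * (catalanConst / 6) * avg L (fun p => MKSE.lap φ p ^ 2) := by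
  have key := sub_mean_sq_le_unit h.rescale (p.1 / L, p.2 / L)
  simp only [lap_rescale, mul_pow] at key
  rw [avg_const_mul, avg_rescale hL h.continuous,
    avg_rescale hL (φ := fun p => MKSE.lap φ p ^ 2) (h.lap.pow 2).continuous,
    mul_div_cancel₀ _ hL.ne', mul_div_cancel₀ _ hL.ne'] at key
  refine key.trans (le_of_eq ?_)
  have := Real.pi_ne_zero
  field_simp
  ring

theorem Per.poincare (h : Per L φ) (hL : 0 < L) (h0 : avg L φ = 0) :
    avg L (fun p => φ p ^ 2) ≤
      ((L / (2 * Real.pi)) ^ 2) ^ 2 * avg L (fun p => MKSE.lap φ p ^ 2) := by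
  have key := poincare_unit h.rescale (by rw [avg_rescale hL h.continuous, h0, zero_div])
  simp only [lap_rescale, mul_pow] at key
  rw [avg_const_mul, avg_rescale hL (φ := fun p => φ p ^ 2) (h.pow 2).continuous,
    avg_rescale hL (φ := fun p => MKSE.lap φ p ^ 2) (h.lap.pow 2).continuous] at key
  have hpi := Real.pi_pos
  have e : ((L / (2 * Real.pi)) ^ 2) ^ 2 * avg L (fun p => MKSE.lap φ p ^ 2) =
      L ^ 2 / ((4 * Real.pi ^ 2) ^ 2) * ((L ^ 2) ^ 2 * (avg L (fun p => MKSE.lap φ p ^ 2) / L ^ 2)) := by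
    field_simp
    ring
  rw [e]
  calc avg L (fun p => φ p ^ 2) = L ^ 2 / ((4 * Real.pi ^ 2) ^ 2) *
        (4 ^ 2 * (Real.pi ^ 2) ^ 2 * (avg L (fun p => φ p ^ 2) / L ^ 2)) := by field_simp
    _ ≤ _ := by gcongr

end Scaling

end MKSE

/-! ### Asymptotic bounds for a single solution. -/

namespace MKSE

variable {L lam : ℝ} {φ : ℝ × ℝ → ℝ} {u : ℝ → ℝ × ℝ → ℝ} {t : ℝ}

theorem lintegral_enorm_sq (h : Continuous φ) :
    ∫⁻ p in square L, ‖φ p‖ₑ ^ 2 = ENNReal.ofReal (avg L (fun p => φ p ^ 2)) := by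
  have hi : Integrable (fun p => φ p ^ 2) (volume.restrict (square L)) :=
    Continuous.integrableOn_square (by fun_prop)
  rw [avg, ofReal_integral_eq_lintegral_ofReal hi (Eventually.of_forall fun p => sq_nonneg _)]
  refine lintegral_congr fun p => ?_
  rw [← ofReal_norm, ← ENNReal.ofReal_pow (norm_nonneg _), Real.norm_eq_abs, sq_abs]

theorem avg_sq_nonneg (L : ℝ) (φ : ℝ × ℝ → ℝ) : 0 ≤ avg L (fun p => φ p ^ 2) :=
  avg_nonneg fun _ => sq_nonneg _

theorem grad2_nonneg (L : ℝ) (φ : ℝ × ℝ → ℝ) : 0 ≤ grad2 L φ :=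
  avg_nonneg fun _ => by positivity

theorem Per.J_zero (h : Per L φ) : J L 0 φ = ENNReal.ofReal (avg L (fun p => φ p ^ 2)) := by
  simp [J, lintegral_enorm_sq h.continuous]

/-- The binomial weights 1, 2, 1 are those of the squared Hessian, whose integral equals that of
(Δφ)². -/
theorem Per.J_two (h : Per L φ) (hL : 0 ≤ L) :
    J L 2 φ = ENNReal.ofReal (avg L (fun p => MKSE.lap φ p ^ 2)) := by
  rw [J, Finset.Nat.sum_antidiagonal_eq_sum_range_succ_mk]
  simp only [Finset.sum_range_succ, Finset.sum_range_zero, Function.iterate_succ,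
    Function.iterate_zero, Function.comp, id, Nat.sub_zero, Nat.choose_zero_right, Nat.cast_one,
    one_mul, zero_add, Nat.choose_one_right, Nat.choose_self, Nat.sub_self,
    show 2 - 1 = 1 from rfl]
  rw [lintegral_enorm_sq h.dy.dy.continuous, lintegral_enorm_sq h.dy.dx.continuous,
    lintegral_enorm_sq h.dx.dx.continuous, ← h.avg_hessian hL,
    ← ENNReal.ofReal_natCast, ← ENNReal.ofReal_mul (by positivity),
    ← ENNReal.ofReal_add (avg_sq_nonneg _ _) (mul_nonneg (by positivity) (avg_sq_nonneg _ _)),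
    ← ENNReal.ofReal_add (add_nonneg (avg_sq_nonneg _ _)
      (mul_nonneg (by positivity) (avg_sq_nonneg _ _))) (avg_sq_nonneg _ _)]
  congr 1
  push_cast
  ring

theorem ofReal_rpow_half {a : ℝ} (ha : 0 ≤ a) :
    ENNReal.ofReal a ^ (1 / 2 : ℝ) = ENNReal.ofReal √a := by
  rw [ENNReal.ofReal_rpow_of_nonneg ha (by norm_num), Real.sqrt_eq_rpow]

/-- The sharp bound of the supremum norm. -/
theorem Per.supNorm_le (h : Per L φ) (hL : 0 < L) :
    supNorm L φ ≤ ENNReal.ofReal (L / (2 * Real.pi) * √(catalanConst / 6)) *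
        J L 2 φ ^ (1 / 2 : ℝ) + ENNReal.ofReal L⁻¹ * J L 0 φ ^ (1 / 2 : ℝ) := by
  have hpi := Real.pi_pos
  refine iSup₂_le fun p _ => ?_
  rw [h.J_two hL.le, h.J_zero, ofReal_rpow_half (avg_sq_nonneg _ _),
    ofReal_rpow_half (avg_sq_nonneg _ _), ← ENNReal.ofReal_mul (by positivity),
    ← ENNReal.ofReal_mul (by positivity), ← ENNReal.ofReal_add (by positivity) (by positivity),
    ← ofReal_norm]
  refine ENNReal.ofReal_le_ofReal ?_
  have h1 : |φ p - avg L φ / L ^ 2| ≤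
      L / (2 * Real.pi) * √(catalanConst / 6) * √(avg L (fun p => MKSE.lap φ p ^ 2)) := by
    refine abs_le_of_sq_le_sq ?_ (by positivity)
    rw [mul_pow, mul_pow, Real.sq_sqrt (avg_sq_nonneg _ _),
      Real.sq_sqrt (div_nonneg catalanConst_nonneg (by norm_num))]
    exact h.sub_mean_sq_le hL p
  have h2 : |avg L φ / L ^ 2| ≤ L⁻¹ * √(avg L (fun p => φ p ^ 2)) := by
    have cs := avg_mul_sq_le (L := L) h.continuous (continuous_const (y := (1 : ℝ)))
    rw [avg_const hL.le] at cs
    simp only [mul_one, one_pow] at cs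
    refine abs_le_of_sq_le_sq ?_ (by positivity)
    rw [mul_pow, Real.sq_sqrt (avg_sq_nonneg _ _), div_pow, div_le_iff₀ (by positivity)]
    refine cs.trans (le_of_eq ?_)
    field_simp
  calc ‖φ p‖ = |(φ p - avg L φ / L ^ 2) + avg L φ / L ^ 2| := by rw [sub_add_cancel]; rfl
    _ ≤ _ := abs_add_le _ _
    _ ≤ _ := add_le_add h1 h2

theorem Per.avg_lap (h : Per L φ) (hL : 0 ≤ L) : avg L (MKSE.lap φ) = 0 := by
  have := avg_add (L := L) h.dx.dx.continuous h.dy.dy.continuous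
  rw [h.dx.avg_dx hL, h.dy.avg_dy hL, add_zero] at this
  exact this

theorem Per.poincare_lap (h : Per L φ) (hL : 0 < L) :
    avg L (fun p => MKSE.lap φ p ^ 2) ≤ ((L / (2 * Real.pi)) ^ 2) ^ 2 *
      avg L (fun p => MKSE.lap (MKSE.lap φ) p ^ 2) :=
  h.lap.poincare hL (h.avg_lap hL.le)

/-- Subtracting the mean changes neither ∇φ nor Δφ; for the mean-free function, combine A1² ≤ A0 A2
with Poincaré for A0. -/
theorem Per.poincare_grad2 (h : Per L φ) (hL : 0 < L) :
    grad2 L φ ≤ (L / (2 * Real.pi)) ^ 2 * avg L (fun p => MKSE.lap φ p ^ 2) := by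
  have hsub := h.sub (Per.const (L := L) (avg L φ / L ^ 2))
  have hx : MKSE.dx (fun p => φ p - avg L φ / L ^ 2) = MKSE.dx φ := by
    ext p; exact deriv_sub_const _
  have hy : MKSE.dy (fun p => φ p - avg L φ / L ^ 2) = MKSE.dy φ := by
    ext p; exact deriv_sub_const _
  have hg : grad2 L (fun p => φ p - avg L φ / L ^ 2) = grad2 L φ := by rw [grad2, hx, hy]; rfl
  have hl : MKSE.lap (fun p => φ p - avg L φ / L ^ 2) = MKSE.lap φ := by
    ext p; rw [MKSE.lap, hx, hy]; rfl
  have h0 : avg L (fun p => φ p - avg L φ / L ^ 2) = 0 := by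
    rw [avg_sub h.continuous continuous_const, avg_const hL.le, mul_div_cancel₀ _ (by positivity),
      sub_self]
  have h1 := hsub.grad2_sq_le hL.le
  have h2 := hsub.poincare hL h0
  rw [hl] at h1 h2
  rw [hg] at h1
  refine abs_le_of_sq_le_sq' ?_ (mul_nonneg (by positivity) (avg_sq_nonneg _ _)) |>.2
  calc _ ≤ _ := h1
    _ ≤ _ := mul_le_mul_of_nonneg_right h2 (avg_sq_nonneg _ _)
    _ = _ := by ring

theorem IsSolution.dt_eq_rhs (h : IsSolution L lam u) (ht : 0 < t) (p : ℝ × ℝ) :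
    dt u t p = rhs lam (u t) p := h.equation t ht p

theorem IsSolution.hasDerivAt_L2 (h : IsSolution L lam u) (ht : 0 < t) :
    HasDerivAt (fun s => avg L (fun p => u s p ^ 2))
      (2 * avg L (fun p => u t p * rhs lam (u t) p)) t := by
  simpa only [h.dt_eq_rhs ht] using h.hasDerivAt_energy ht

theorem IsSolution.hasDerivAt_lap_L2 (h : IsSolution L lam u) (hL : 0 ≤ L) (ht : 0 < t) :
    HasDerivAt (fun s => avg L (fun p => lap (u s) p ^ 2))
      (2 * avg L (fun p => lap (lap (u t)) p * rhs lam (u t) p)) t := by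
  simpa only [h.dt_eq_rhs ht] using h.hasDerivAt_lap_energy hL ht

theorem IsSolution.limsup_J_zero_eq (h : IsSolution L lam u) :
    limsup (fun t => J L 0 (u t)) atTop =
      limsup (fun t => ENNReal.ofReal (avg L (fun p => u t p ^ 2))) atTop :=
  limsup_congr ((eventually_gt_atTop 0).mono fun _ ht => (h.per ht).J_zero)

theorem IsSolution.limsup_J_two_eq (h : IsSolution L lam u) (hL : 0 ≤ L) :
    limsup (fun t => J L 2 (u t)) atTop =
      limsup (fun t => ENNReal.ofReal (avg L (fun p => lap (u t) p ^ 2))) atTop :=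
  limsup_congr ((eventually_gt_atTop 0).mono fun _ ht => (h.per ht).J_two hL)

theorem IsSolution.limsup_J_zero_le (h : IsSolution L lam u) (hL : 0 < L) (hlam : 0 < lam) :
    limsup (fun t => J L 0 (u t)) atTop ≤ ENNReal.ofReal (B₀ L lam) := by
  rw [h.limsup_J_zero_eq]
  refine limsup_ofReal_le_of_forall_gt fun M' hM' => ?_
  have hB : 0 < B₀ L lam := by unfold B₀; positivity
  have hη : 0 < 2 * (M' * (M' - B₀ L lam) / L ^ 2) := by
    have := sub_pos.2 hM'
    have := hB.trans hM'
    positivity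
  refine eventually_le_of_deriv_le_neg (T := 0) hη (fun t ht => h.hasDerivAt_L2 ht)
    fun t ht hle => ?_
  have key := (h.per ht).energy_le hL lam
  set A := avg L (fun p => u t p ^ 2)
  -- The logistic form: above any M' > B_0 the decay rate is bounded away from zero.
  have e : (lam + 1 / 4) * A - A ^ 2 / L ^ 2 = -(A * (A - B₀ L lam) / L ^ 2) := by
    unfold B₀; field_simp; ring
  have h2 : M' * (M' - B₀ L lam) / L ^ 2 ≤ A * (A - B₀ L lam) / L ^ 2 := by
    gcongr
    linarith
  rw [e] at key
  linarith

theorem IsSolution.eventually_avg_le (h : IsSolution L lam u) {b : ℝ}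
    (hb : limsup (fun t => J L 0 (u t)) atTop < ENNReal.ofReal b) :
    ∀ᶠ t in atTop, avg L (fun p => u t p ^ 2) ≤ b := by
  rw [h.limsup_J_zero_eq] at hb
  refine (eventually_lt_of_limsup_lt hb).mono fun t ht => ?_
  exact le_of_lt (ENNReal.ofReal_lt_ofReal_iff'.1 ht).1

/-- Reduces every bound of J_2 to strict decay of ∫(Δu)² above each level M' > M, at large times. -/
theorem IsSolution.limsup_J_two_le (h : IsSolution L lam u) (hL : 0 ≤ L) {M : ℝ}
    (H : ∀ M', M < M' → ∃ η, 0 < η ∧ ∀ᶠ t in atTop, M' ≤ avg L (fun p => lap (u t) p ^ 2) →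
      avg L (fun p => lap (lap (u t)) p * rhs lam (u t) p) ≤ -η) :
    limsup (fun t => J L 2 (u t)) atTop ≤ ENNReal.ofReal M := by
  rw [h.limsup_J_two_eq hL]
  refine limsup_ofReal_le_of_forall_gt fun M' hM' => ?_
  obtain ⟨η, hη, hev⟩ := H M' hM'
  obtain ⟨T, hT⟩ := eventually_atTop.1 hev
  refine eventually_le_of_deriv_le_neg (T := max T 0) (η := 2 * η) (by linarith)
    (fun t ht => h.hasDerivAt_lap_L2 hL ((le_max_right _ _).trans_lt ht)) fun t ht hle => ?_
  have := hT t ((le_max_left _ _).trans ht.le) hle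
  linarith

/-- The estimate of `J_2` from an asymptotic bound of `J_0`. -/
theorem IsSolution.limsup_J_two_le_of_bound (h : IsSolution L lam u) (hL : 0 < L) (hlam : 0 < lam)
    {b : ℝ} (hb : limsup (fun t => J L 0 (u t)) atTop < ENNReal.ofReal b) :
    limsup (fun t => J L 2 (u t)) atTop ≤ ENNReal.ofReal (b * √(bracketReal lam b)) := by
  have hb0 : 0 < b := ENNReal.ofReal_pos.1 (pos_of_gt hb)
  refine h.limsup_J_two_le hL.le fun M' hM' => ?_
  have hG := bracketReal_pos lam b
  have hM0 : 0 < M' := lt_of_le_of_lt (by positivity) hM'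
  have hM2 : b ^ 2 * bracketReal lam b < M' ^ 2 := by
    have := pow_lt_pow_left₀ hM' (by positivity) two_ne_zero
    rwa [mul_pow, Real.sq_sqrt hG.le] at this
  refine ⟨(M' ^ 2 / b - bracketReal lam b * b) / 4, ?_, ?_⟩
  · have : bracketReal lam b * b < M' ^ 2 / b := by
      rw [lt_div_iff₀ hb0]; linarith
    linarith
  filter_upwards [h.eventually_avg_le hb, eventually_gt_atTop 0] with t hA0 ht hle
  have hp := h.per ht
  have key := (hp.ladder hL lam).trans (ladder_le_bracket lam (avg_sq_nonneg _ _)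
    (grad2_nonneg _ _) (grad2_nonneg _ _) (avg_sq_nonneg _ _) hlam.le (hp.grad2_sq_le hL.le)
    (hp.avg_lap_sq_sq_le hL.le) (hp.lap.grad2_sq_le hL.le))
  have i2 := hp.avg_lap_sq_sq_le hL.le
  have n4 := avg_sq_nonneg L (lap (lap (u t)))
  have n0 := avg_sq_nonneg L (u t)
  -- Interpolation A2² ≤ A0 A4 read backwards: a large A2 with bounded A0 makes the dissipation A4
  -- large.
  have h4 : M' ^ 2 / b ≤ avg L (fun p => lap (lap (u t)) p ^ 2) := by
    rw [div_le_iff₀ hb0]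
    calc M' ^ 2 ≤ _ := pow_le_pow_left₀ hM0.le hle 2
      _ ≤ _ := i2
      _ ≤ b * _ := mul_le_mul_of_nonneg_right hA0 n4
      _ = _ := mul_comm _ _
  have h5 : bracketReal lam (avg L (fun p => u t p ^ 2)) * avg L (fun p => u t p ^ 2) ≤
      bracketReal lam b * b :=
    mul_le_mul (bracketReal_mono lam n0 hA0) hA0 n0 hG.le
  linarith

theorem bracket_ofReal {a : ℝ} (ha : 0 ≤ a) (lam : ℝ) :
    bracket lam (ENNReal.ofReal a) = ENNReal.ofReal (bracketReal lam a) := by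
  rw [bracket, bracketReal, ← ENNReal.ofReal_pow ha, ← ENNReal.ofReal_pow ha,
    ← ENNReal.ofReal_mul (by positivity), ← ENNReal.ofReal_mul (by positivity),
    ← ENNReal.ofReal_add (by positivity) (by positivity),
    ← ENNReal.ofReal_add (by positivity) (by positivity)]

theorem bracket_mono (lam : ℝ) : Monotone (bracket lam) := fun a b hab => by
  unfold bracket; gcongr

theorem IsSolution.limsup_J_two_le_mul (h : IsSolution L lam u) (hL : 0 < L) (hlam : 0 < lam) :
    limsup (fun t => J L 2 (u t)) atTop ≤ limsup (fun t => J L 0 (u t)) atTop *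
      bracket lam (limsup (fun t => J L 0 (u t)) atTop) ^ (1 / 2 : ℝ) := by
  have hfin := ((h.limsup_J_zero_le hL hlam).trans_lt ENNReal.ofReal_lt_top).ne
  obtain ⟨a, ha, hea⟩ : ∃ a : ℝ, 0 ≤ a ∧ limsup (fun t => J L 0 (u t)) atTop = ENNReal.ofReal a :=
    ⟨_, ENNReal.toReal_nonneg, (ENNReal.ofReal_toReal hfin).symm⟩
  rw [hea, bracket_ofReal ha, ofReal_rpow_half (bracketReal_pos lam a).le,
    ← ENNReal.ofReal_mul ha]
  have hcont : Continuous fun b => ENNReal.ofReal (b * √(bracketReal lam b)) :=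
    ENNReal.continuous_ofReal.comp
      (continuous_id.mul (Real.continuous_sqrt.comp (continuous_bracketReal lam)))
  -- The estimate is known for every b strictly above the limit superior a of J_0; letting b
  -- decrease to a also handles a = 0.
  refine ge_of_tendsto ((hcont.tendsto a).mono_left (nhdsWithin_le_nhds (s := Ioi a))) ?_
  filter_upwards [self_mem_nhdsWithin] with b hb
  refine h.limsup_J_two_le_of_bound hL hlam ?_
  rw [hea]
  exact (ENNReal.ofReal_lt_ofReal_iff (ha.trans_lt hb)).2 hb

end MKSE

/-! ### Families of solutions and the explicit bound. -/

namespace MKSE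

variable {L lam : ℝ} {u : ℝ → ℝ × ℝ → ℝ} {U : Set (ℝ → ℝ × ℝ → ℝ)}

theorem limsup_le_overbar (F : (ℝ × ℝ → ℝ) → ℝ≥0∞) (hu : u ∈ U) :
    limsup (fun t => F (u t)) atTop ≤ overbar U F :=
  le_iSup₂ (f := fun u (_ : u ∈ U) => limsup (fun t => F (u t)) atTop) u hu

theorem limsup_rpow (f : ℝ → ℝ≥0∞) {r : ℝ} (hr : 0 ≤ r) :
    limsup (fun t => f t ^ r) atTop = limsup f atTop ^ r :=
  ((ENNReal.monotone_rpow_of_nonneg hr).map_limsup_of_continuousAt f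
    ENNReal.continuous_rpow_const.continuousAt).symm

theorem limsup_add_le_add_limsup (f g : ℝ → ℝ≥0∞) :
    limsup (f + g) atTop ≤ limsup f atTop + limsup g atTop := by
  refine ENNReal.le_of_forall_pos_le_add fun ε hε hlt => ?_
  obtain ⟨hf, hg⟩ := ENNReal.add_lt_top.1 hlt
  have hε2 : ((ε / 2 : NNReal) : ℝ≥0∞) ≠ 0 := by simpa using hε.ne'
  have hf' := eventually_lt_of_limsup_lt (ENNReal.lt_add_right hf.ne hε2)
  have hg' := eventually_lt_of_limsup_lt (ENNReal.lt_add_right hg.ne hε2)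
  have e : (ε : ℝ≥0∞) = ((ε / 2 : NNReal) : ℝ≥0∞) + ((ε / 2 : NNReal) : ℝ≥0∞) := by
    rw [← ENNReal.coe_add, add_halves]
  rw [e, add_add_add_comm]
  exact limsup_le_of_le (h := (hf'.and hg').mono fun t ht => add_le_add ht.1.le ht.2.le)

theorem overbar_supNorm_le (hL : 0 < L) (hU : ∀ u ∈ U, IsSolution L lam u) :
    overbar U (supNorm L) ≤
      ENNReal.ofReal (L / (2 * Real.pi) * √(catalanConst / 6)) * overbar U (J L 2) ^ (1 / 2 : ℝ)
        + ENNReal.ofReal L⁻¹ * overbar U (J L 0) ^ (1 / 2 : ℝ) := by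
  refine iSup₂_le fun u hu => ?_
  calc limsup (fun t => supNorm L (u t)) atTop
      ≤ limsup ((fun t => ENNReal.ofReal (L / (2 * Real.pi) * √(catalanConst / 6)) *
          J L 2 (u t) ^ (1 / 2 : ℝ)) + fun t => ENNReal.ofReal L⁻¹ * J L 0 (u t) ^ (1 / 2 : ℝ))
          atTop := limsup_le_limsup ((eventually_gt_atTop 0).mono fun t ht =>
            ((hU u hu).per ht).supNorm_le hL)
    _ ≤ _ := limsup_add_le_add_limsup _ _
    _ ≤ _ := by
        rw [ENNReal.limsup_const_mul_of_ne_top ENNReal.ofReal_ne_top,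
          ENNReal.limsup_const_mul_of_ne_top ENNReal.ofReal_ne_top,
          limsup_rpow (fun t => J L 2 (u t)) (by norm_num),
          limsup_rpow (fun t => J L 0 (u t)) (by norm_num)]
        gcongr
        · exact limsup_le_overbar (J L 2) hu
        · exact limsup_le_overbar (J L 0) hu

theorem overbar_J_zero_le (hL : 0 < L) (hlam : 0 < lam) (hU : ∀ u ∈ U, IsSolution L lam u) :
    overbar U (J L 0) ≤ ENNReal.ofReal (B₀ L lam) :=
  iSup₂_le fun u hu => (hU u hu).limsup_J_zero_le hL hlam

theorem overbar_J_two_le (hL : 0 < L) (hlam : 0 < lam) (hU : ∀ u ∈ U, IsSolution L lam u) :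
    overbar U (J L 2) ≤
      overbar U (J L 0) * bracket lam (overbar U (J L 0)) ^ (1 / 2 : ℝ) := by
  refine iSup₂_le fun u hu => ((hU u hu).limsup_J_two_le_mul hL hlam).trans ?_
  have h := limsup_le_overbar (J L 0) hu
  have hb := bracket_mono lam h
  gcongr

/-! ### Poincaré's inequality for small B_0, and the constants of the explicit bound. -/

section SmallDomains

theorem B₀_pos (hL : 0 < L) (hlam : 0 < lam) : 0 < B₀ L lam := by unfold B₀; positivity

theorem kappa_le (hlam : 0 < lam) : (L / (2 * Real.pi)) ^ 2 ≤ B₀ L lam / Real.pi ^ 2 := by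
  have := Real.pi_pos
  rw [div_pow, mul_pow, div_le_div_iff₀ (by positivity) (by positivity), B₀]
  have : 0 ≤ L ^ 2 * lam := by positivity
  nlinarith [sq_nonneg Real.pi, mul_nonneg this (sq_nonneg Real.pi)]

/-- Arithmetic-geometric mean: λ ≤ (λ + 1/4)², the defect being (λ - 1/4)². -/
theorem lam_mul_kappa_sq_le :
    lam * ((L / (2 * Real.pi)) ^ 2) ^ 2 ≤ (B₀ L lam / Real.pi ^ 2) ^ 2 / 16 := by
  have e : (B₀ L lam / Real.pi ^ 2) ^ 2 / 16 - lam * ((L / (2 * Real.pi)) ^ 2) ^ 2 =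
      (L ^ 2 * (lam - 1 / 4)) ^ 2 / (16 * Real.pi ^ 4) := by
    have := Real.pi_ne_zero
    unfold B₀
    field_simp
    ring
  have : 0 ≤ (L ^ 2 * (lam - 1 / 4)) ^ 2 / (16 * Real.pi ^ 4) := by positivity
  linarith

/-- Since B_0 < 6/5, eventually A0 ≤ 6/5 and Poincaré absorbs all terms, leaving (1/2) dA2/dt ≤
-A4/4 ≤ -A2/(4κ²). -/
theorem IsSolution.limsup_J_two_eq_zero_of_small (h : IsSolution L lam u) (hL : 0 < L)
    (hlam : 0 < lam) (hB : B₀ L lam ≤ 1) : limsup (fun t => J L 2 (u t)) atTop = 0 := by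
  have hpi := Real.pi_pos
  set κ := (L / (2 * Real.pi)) ^ 2 with hκdef
  have hκ0 : 0 < κ := by positivity
  have hx : B₀ L lam / Real.pi ^ 2 ≤ 1 / 9 := by
    rw [div_le_div_iff₀ (by positivity) (by norm_num)]
    nlinarith [Real.pi_gt_three]
  have hx0 : 0 ≤ B₀ L lam / Real.pi ^ 2 := (div_pos (B₀_pos hL hlam) (by positivity)).le
  have hκ : κ ≤ 1 / 9 := (kappa_le hlam).trans hx
  have hlin : lam * κ ^ 2 ≤ 1 / 100 := lam_mul_kappa_sq_le.trans (by nlinarith)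
  have hb : limsup (fun t => J L 0 (u t)) atTop < ENNReal.ofReal (6 / 5) :=
    (h.limsup_J_zero_le hL hlam).trans_lt
      ((ENNReal.ofReal_lt_ofReal_iff (by norm_num)).2 (by linarith))
  rw [← nonpos_iff_eq_zero, ← ENNReal.ofReal_zero]
  refine h.limsup_J_two_le hL.le fun M' hM' => ⟨M' / κ ^ 2 / 4, by positivity, ?_⟩
  filter_upwards [h.eventually_avg_le hb, eventually_gt_atTop 0] with t hA0 ht hle
  have hp := h.per ht
  have key := (hp.ladder hL lam).trans (ladder_le_of_small (avg_sq_nonneg _ _)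
    (grad2_nonneg _ _) (avg_sq_nonneg _ _) (grad2_nonneg _ _) (avg_sq_nonneg _ _) hlam.le hκ0.le hκ
    hlin hA0 (hp.poincare_grad2 hL) (hp.grad2_sq_le hL.le)
    (hp.avg_lap_sq_sq_le hL.le) (hp.lap.grad2_sq_le hL.le) (hp.poincare_lap hL))
  have h4 : M' / κ ^ 2 ≤ avg L (fun p => lap (lap (u t)) p ^ 2) := by
    rw [div_le_iff₀ (by positivity), mul_comm]
    exact hle.trans (hp.poincare_lap hL)
  linarith

theorem pi_pow_six_lt : Real.pi ^ 6 < 962 := by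
  have h1 : Real.pi ^ 6 < 3.1416 ^ 6 := by
    gcongr
    exact Real.pi_lt_d4
  exact h1.trans (by norm_num)

theorem pi_pow_eight_lt : Real.pi ^ 8 < 9500 := by
  have h1 : Real.pi ^ 8 < 3.1416 ^ 8 := by
    gcongr
    exact Real.pi_lt_d4
  exact h1.trans (by norm_num)

theorem IsSolution.limsup_J_two_le_of_moderate (h : IsSolution L lam u) (hL : 0 < L)
    (hlam : 0 < lam) (hB1 : 1 < B₀ L lam) (hB : B₀ L lam ≤ Real.pi ^ 8 / 1296) :
    limsup (fun t => J L 2 (u t)) atTop ≤ ENNReal.ofReal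
      (36 / Real.pi ^ 4 * (B₀ L lam * √(B₀ L lam) * √(bracketReal lam (B₀ L lam)))) := by
  have hpi := Real.pi_pos
  set β := B₀ L lam with hβ
  have hβ0 : 0 < β := B₀_pos hL hlam
  set κ := (L / (2 * Real.pi)) ^ 2 with hκdef
  have hκ0 : 0 < κ := by positivity
  -- The ceiling on β gives β/π² ≤ π⁶/1296 < 962/1296; with x = 743/1000, x + x²/16 < 39/50.
  have hx : β / Real.pi ^ 2 ≤ 743 / 1000 := by
    rw [div_le_iff₀ (by positivity)]
    have := mul_lt_mul_of_pos_left pi_pow_six_lt (by positivity : 0 < Real.pi ^ 2)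
    nlinarith
  have hx0 : 0 ≤ β / Real.pi ^ 2 := by positivity
  have hlin : κ + lam * κ ^ 2 ≤ 39 / 50 := by
    have h1 : κ ≤ β / Real.pi ^ 2 := kappa_le hlam
    have h2 : lam * κ ^ 2 ≤ (β / Real.pi ^ 2) ^ 2 / 16 := lam_mul_kappa_sq_le
    nlinarith
  set b := 6 / 5 * β with hbdef
  have hb0 : 0 < b := by positivity
  have hb : limsup (fun t => J L 0 (u t)) atTop < ENNReal.ofReal b :=
    (h.limsup_J_zero_le hL hlam).trans_lt
      ((ENNReal.ofReal_lt_ofReal_iff hb0).2 (by rw [hbdef]; linarith))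
  set N := 36 / Real.pi ^ 4 * (β * √β * √(bracketReal lam β)) with hN
  have hN0 : 0 ≤ N := by positivity
  -- Here 4060 = 14·290. Only the quartic coefficient of the bracket is needed, and β > 1 raises all
  -- powers to β⁷.
  have hN2 : 4060 * (6 * b ^ 2 + 81 * b ^ 4) * b ^ 2 ≤ N ^ 2 := by
    have e : N ^ 2 = 1296 / Real.pi ^ 8 * (β ^ 3 * bracketReal lam β) := by
      rw [hN, mul_pow, mul_pow, mul_pow, Real.sq_sqrt hβ0.le,
        Real.sq_sqrt (bracketReal_pos lam β).le]
      ring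
    have h1 : 108 * 19 ^ 4 * β ^ 4 ≤ bracketReal lam β := by
      have := mul_le_mul_of_nonneg_right pi_const_lower (by positivity : 0 ≤ β ^ 4)
      have h2 : 0 ≤ 4 * lam ^ 2 := by positivity
      have h3 : 0 ≤ 108 * (5 / √Real.pi) ^ 4 * β ^ 2 := by positivity
      unfold bracketReal
      linarith
    have h2 : (1296 : ℝ) / 9500 ≤ 1296 / Real.pi ^ 8 := by
      gcongr
      exact pi_pow_eight_lt.le
    have h3 : β ^ 4 ≤ β ^ 7 := pow_le_pow_right₀ hB1.le (by norm_num)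
    have h4 : β ^ 6 ≤ β ^ 7 := pow_le_pow_right₀ hB1.le (by norm_num)
    calc 4060 * (6 * b ^ 2 + 81 * b ^ 4) * b ^ 2
        = 4060 * (6 * (6 / 5) ^ 4 * β ^ 4 + 81 * (6 / 5) ^ 6 * β ^ 6) := by rw [hbdef]; ring
      _ ≤ 4060 * (6 * (6 / 5) ^ 4 * β ^ 7 + 81 * (6 / 5) ^ 6 * β ^ 7) := by gcongr
      _ ≤ 1296 / 9500 * (β ^ 3 * (108 * 19 ^ 4 * β ^ 4)) := by
        have : 0 ≤ β ^ 7 := by positivity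
        have e' : β ^ 3 * (108 * 19 ^ 4 * β ^ 4) = 108 * 19 ^ 4 * β ^ 7 := by ring
        rw [e']
        linarith
      _ ≤ 1296 / Real.pi ^ 8 * (β ^ 3 * bracketReal lam β) := by gcongr
      _ = N ^ 2 := e.symm
  refine h.limsup_J_two_le hL.le fun M' hM' => ?_
  have hM0 : 0 < M' := lt_of_le_of_lt hN0 hM'
  have hM2 : 4060 * (6 * b ^ 2 + 81 * b ^ 4) * b ^ 2 < M' ^ 2 :=
    hN2.trans_lt (pow_lt_pow_left₀ hM' hN0 two_ne_zero)
  refine ⟨M' ^ 2 / b / 14 - 290 * (6 * b ^ 2 + 81 * b ^ 4) * b, ?_, ?_⟩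
  · have : 4060 * (6 * b ^ 2 + 81 * b ^ 4) * b < M' ^ 2 / b := by
      rw [lt_div_iff₀ hb0]; linarith
    linarith
  filter_upwards [h.eventually_avg_le hb, eventually_gt_atTop 0] with t hA0 ht hle
  have hp := h.per ht
  have key := (hp.ladder hL lam).trans (ladder_le_of_poincare (avg_sq_nonneg _ _)
    (grad2_nonneg _ _) (grad2_nonneg _ _) (avg_sq_nonneg _ _) hlam.le hκ0.le hlin
    (hp.grad2_sq_le hL.le) (hp.avg_lap_sq_sq_le hL.le) (hp.lap.grad2_sq_le hL.le)
    (hp.poincare_lap hL))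
  have n4 := avg_sq_nonneg L (lap (lap (u t)))
  have n0 := avg_sq_nonneg L (u t)
  have h4 : M' ^ 2 / b ≤ avg L (fun p => lap (lap (u t)) p ^ 2) := by
    rw [div_le_iff₀ hb0]
    calc M' ^ 2 ≤ _ := pow_le_pow_left₀ hM0.le hle 2
      _ ≤ _ := hp.avg_lap_sq_sq_le hL.le
      _ ≤ b * _ := mul_le_mul_of_nonneg_right hA0 n4
      _ = _ := mul_comm _ _
  have h5 : 290 * (6 * avg L (fun p => u t p ^ 2) ^ 2 + 81 * avg L (fun p => u t p ^ 2) ^ 4) *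
      avg L (fun p => u t p ^ 2) ≤ 290 * (6 * b ^ 2 + 81 * b ^ 4) * b := by gcongr
  linarith

/-- The asymptotic bound of `J_2` behind the explicit estimate of the supremum norm. -/
theorem overbar_J_two_le_explicit (hL : 0 < L) (hlam : 0 < lam)
    (hU : ∀ u ∈ U, IsSolution L lam u) :
    overbar U (J L 2) ≤ ENNReal.ofReal
      (36 / Real.pi ^ 4 * (B₀ L lam * √(B₀ L lam) * √(bracketReal lam (B₀ L lam)))) := by
  have hpi := Real.pi_pos
  have hB := B₀_pos hL hlam
  rcases le_or_gt (B₀ L lam) (Real.pi ^ 8 / 1296) with hle | hgt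
  · refine iSup₂_le fun u hu => ?_
    rcases le_or_gt (B₀ L lam) 1 with h1 | h1
    · rw [(hU u hu).limsup_J_two_eq_zero_of_small hL hlam h1]
      exact zero_le
    · exact (hU u hu).limsup_J_two_le_of_moderate hL hlam h1 hle
  -- For large B_0 the general bound is enough, as 36 B_0^{1/2}/π⁴ ≥ 1.
  · refine (overbar_J_two_le hL hlam hU).trans ?_
    have h0 := overbar_J_zero_le hL hlam hU
    have hb := bracket_mono lam h0
    rw [bracket_ofReal hB.le] at hb
    calc _ ≤ ENNReal.ofReal (B₀ L lam) *
          ENNReal.ofReal (bracketReal lam (B₀ L lam)) ^ (1 / 2 : ℝ) := by gcongr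
      _ = ENNReal.ofReal (B₀ L lam * √(bracketReal lam (B₀ L lam))) := by
        rw [ofReal_rpow_half (bracketReal_pos _ _).le, ENNReal.ofReal_mul hB.le]
      _ ≤ _ := by
        refine ENNReal.ofReal_le_ofReal ?_
        have h1 : Real.pi ^ 4 / 36 ≤ √(B₀ L lam) := by
          refine Real.le_sqrt_of_sq_le ?_
          calc (Real.pi ^ 4 / 36) ^ 2 = Real.pi ^ 8 / 1296 := by ring
            _ ≤ _ := hgt.le
        have h2 : 1 ≤ 36 / Real.pi ^ 4 * √(B₀ L lam) := by
          calc (1 : ℝ) = 36 / Real.pi ^ 4 * (Real.pi ^ 4 / 36) := by field_simp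
            _ ≤ _ := by gcongr
        calc B₀ L lam * √(bracketReal lam (B₀ L lam))
            = 1 * (B₀ L lam * √(bracketReal lam (B₀ L lam))) := (one_mul _).symm
          _ ≤ 36 / Real.pi ^ 4 * √(B₀ L lam) * (B₀ L lam * √(bracketReal lam (B₀ L lam))) := by
            gcongr
          _ = _ := by ring

/-- The root of 36/π⁴ is 6/π², and 6(K/6)^{1/2} = (6K)^{1/2}; this turns the Sobolev constant into
the explicit one. -/
theorem explicit_coefficient (hL : 0 < L) (hlam : 0 < lam) :
    ENNReal.ofReal (L / (2 * Real.pi) * √(catalanConst / 6)) * ENNReal.ofReal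
      (36 / Real.pi ^ 4 * (B₀ L lam * √(B₀ L lam) * √(bracketReal lam (B₀ L lam)))) ^ (1 / 2 : ℝ) =
    ENNReal.ofReal (L / (2 * Real.pi ^ 3) * √(6 * catalanConst)) *
      (ENNReal.ofReal (B₀ L lam) ^ (3 / 2 : ℝ) *
        bracket lam (ENNReal.ofReal (B₀ L lam)) ^ (1 / 2 : ℝ)) ^ (1 / 2 : ℝ) := by
  have hpi := Real.pi_pos
  have hB := B₀_pos hL hlam
  have hG := bracketReal_pos lam (B₀ L lam)
  have h32 : ENNReal.ofReal (B₀ L lam) ^ (3 / 2 : ℝ) = ENNReal.ofReal (B₀ L lam * √(B₀ L lam)) := by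
    rw [show (3 / 2 : ℝ) = 1 + 1 / 2 by norm_num,
      ENNReal.rpow_add_of_nonneg _ _ zero_le_one (by norm_num), ENNReal.rpow_one,
      ofReal_rpow_half hB.le, ENNReal.ofReal_mul hB.le]
  have hK : √(6 * catalanConst) = 6 * √(catalanConst / 6) := by
    rw [show 6 * catalanConst = 6 ^ 2 * (catalanConst / 6) by ring,
      Real.sqrt_mul (by norm_num), Real.sqrt_sq (by norm_num)]
  have h36 : √(36 / Real.pi ^ 4) = 6 / Real.pi ^ 2 := by
    rw [show 36 / Real.pi ^ 4 = (6 / Real.pi ^ 2) ^ 2 by ring, Real.sqrt_sq (by positivity)]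
  rw [bracket_ofReal hB.le, h32, ofReal_rpow_half hG.le, ← ENNReal.ofReal_mul (by positivity),
    ofReal_rpow_half (by positivity), ofReal_rpow_half (by positivity),
    ← ENNReal.ofReal_mul (by positivity), ← ENNReal.ofReal_mul (by positivity),
    Real.sqrt_mul (by positivity), h36, hK]
  congr 1
  field_simp

end SmallDomains

end MKSE

theorem mainTheorem9 (L lam : ℝ) (hL : 0 < L) (hlam : 0 < lam)
    (U : Set (ℝ → ℝ × ℝ → ℝ)) (hU : ∀ u ∈ U, MKSE.IsSolution L lam u) :
    -- the sup-norm bound in terms of the asymptotic values of `J_2` and `J_0`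
    MKSE.overbar U (MKSE.supNorm L) ≤
        ENNReal.ofReal (L / (2 * Real.pi) * √(MKSE.catalanConst / 6))
            * MKSE.overbar U (MKSE.J L 2) ^ (1 / 2 : ℝ)
          + ENNReal.ofReal L⁻¹ * MKSE.overbar U (MKSE.J L 0) ^ (1 / 2 : ℝ) ∧
    -- the estimate for `J_0`
    MKSE.overbar U (MKSE.J L 0) ≤ ENNReal.ofReal (MKSE.B₀ L lam) ∧
    -- the estimate for `J_2`
    MKSE.overbar U (MKSE.J L 2) ≤
        MKSE.overbar U (MKSE.J L 0)
          * MKSE.bracket lam (MKSE.overbar U (MKSE.J L 0)) ^ (1 / 2 : ℝ) ∧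
    -- the fully explicit sup-norm bound
    MKSE.overbar U (MKSE.supNorm L) ≤
        ENNReal.ofReal (L / (2 * Real.pi ^ 3) * √(6 * MKSE.catalanConst))
            * (ENNReal.ofReal (MKSE.B₀ L lam) ^ (3 / 2 : ℝ)
                * MKSE.bracket lam (ENNReal.ofReal (MKSE.B₀ L lam)) ^ (1 / 2 : ℝ)) ^ (1 / 2 : ℝ)
          + ENNReal.ofReal L⁻¹ * ENNReal.ofReal (MKSE.B₀ L lam) ^ (1 / 2 : ℝ) := by
  refine ⟨MKSE.overbar_supNorm_le hL hU, MKSE.overbar_J_zero_le hL hlam hU,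
    MKSE.overbar_J_two_le hL hlam hU, ?_⟩
  rw [← MKSE.explicit_coefficient hL hlam]
  refine (MKSE.overbar_supNorm_le hL hU).trans ?_
  have h2 := MKSE.overbar_J_two_le_explicit hL hlam hU
  have h0 := MKSE.overbar_J_zero_le hL hlam hU
  gcongr
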